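/- Let $R$ be a field, let $X$, $Y$ be topological spaces and let $f : X \to Y$ be continuous. Write $H^n(-;R)$ for singular cohomology with coefficients in $R$. Let $\mathcal V = (V_i)_{i \in I}$ be a finite open cover of $f(X)$, that is, $I$ is finite, $f(X) \subseteq \bigcup_{i} V_i$, and the $V_i \subseteq Y$ are sets whose traces $V_i \cap f(X)$ are open in $f(X)$ (for instance open subsets of $f(X)$, or open subsets of $Y$). The nerve $N_{\mathcal V}$ is the abstract simplicial complex whose simplices are the non-empty finite sets $\sigma \subseteq I$ with non-empty support $V_\sigma = \bigcap_{i \in \sigma} V_i$. For $n \ge 0$ the Leray cellular sheaf $\mathcal L^n$ on $N_{\mathcal V}$ assigns to a simplex $\sigma$ the $R$-module $\mathcal L^n(\sigma) = H^n(f^{-1}(V_\sigma);R)$, and to a face relation $\sigma \subseteq \tau$ the map $\mathcal L^n_{\sigma\tau}$ induced by the inclusion $f^{-1}(V_\tau) \hookrightarrow f^{-1}(V_\sigma)$; put $\mathcal L^{-1} = 0$. The cohomology $H^k(N_{\mathcal V};\mathcal F)$ of a cellular sheaf $\mathcal F$ is that of the complex $C^k = \bigoplus_{\dim \sigma = k}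 \mathcal F(\sigma)$ with $(\delta\varphi)(\tau) = \sum_{\sigma} [\sigma:\tau]\, \mathcal F_{\sigma\tau}(\varphi(\sigma))$, summed over the facets $\sigma$ of $\tau$, where $[\sigma:\tau] = \pm 1$ is the incidence number for the orientation given by a linear order of $I$. Assume that $N_{\mathcal V}$ is at most one-dimensional. Then, for each integer $n \ge 0$, there is an isomorphism of $R$-vector spaces $$H^n(X;R) \cong H^0(N_{\mathcal V};\mathcal L^n) \oplus H^1(N_{\mathcal V};\mathcal L^{n-1}).$$ -/

import Mathlib

noncomputable section

universe u v w

/-! ### Cohomology of a sequence of modules and linear maps -/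

section Cohomology

variable {R : Type*} [CommRing R]
  {C : ℕ → Type*} [∀ n, AddCommGroup (C n)] [∀ n, Module R (C n)]
  {D : ℕ → Type*} [∀ n, AddCommGroup (D n)] [∀ n, Module R (D n)]

/-- The coboundaries in degree `n`: the image of the incoming differential (zero in degree `0`). -/
def coboundaries (d : ∀ n, C n →ₗ[R] C (n + 1)) : ∀ n, Submodule R (C n)
  | 0 => ⊥
  | n + 1 => LinearMap.range (d n)

/-- The `n`-th cohomology `ker dⁿ / im dⁿ⁻¹` of the cochain complex `C⁰ → C¹ → C² → ⋯`. -/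
abbrev Cohomology (d : ∀ n, C n →ₗ[R] C (n + 1)) (n : ℕ) : Type _ :=
  LinearMap.ker (d n) ⧸ (coboundaries d n).submoduleOf (LinearMap.ker (d n))

theorem coboundaries_le_comap (d : ∀ n, C n →ₗ[R] C (n + 1)) (e : ∀ n, D n →ₗ[R] D (n + 1))
    (g : ∀ n, C n →ₗ[R] D n) (hg : ∀ n x, e n (g n x) = g (n + 1) (d n x)) (n : ℕ) :
    coboundaries d n ≤ (coboundaries e n).comap (g n) := by
  cases n with
  | zero => exact bot_le
  | succ n =>
    rintro _ ⟨x, rfl⟩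
    exact ⟨g n x, hg n x⟩

/-- The map induced on cocycles by a cochain map `g`. -/
def cocyclesMap (d : ∀ n, C n →ₗ[R] C (n + 1)) (e : ∀ n, D n →ₗ[R] D (n + 1))
    (g : ∀ n, C n →ₗ[R] D n) (hg : ∀ n x, e n (g n x) = g (n + 1) (d n x)) (n : ℕ) :
    LinearMap.ker (d n) →ₗ[R] LinearMap.ker (e n) :=
  (g n).restrict fun x hx => by
    rw [LinearMap.mem_ker] at hx ⊢
    rw [hg, hx, map_zero]

/-- The map induced on cohomology by a cochain map `g`. -/
def Cohomology.map (d : ∀ n, C n →ₗ[R] C (n + 1)) (e : ∀ n, D n →ₗ[R] D (n + 1))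
    (g : ∀ n, C n →ₗ[R] D n) (hg : ∀ n x, e n (g n x) = g (n + 1) (d n x)) (n : ℕ) :
    Cohomology d n →ₗ[R] Cohomology e n :=
  Submodule.mapQ _ _ (cocyclesMap d e g hg n) fun _ hx =>
    coboundaries_le_comap d e g hg n hx

end Cohomology

/-! ### Singular cohomology -/

section Singular

/-- Singular `n`-simplices of `X`: continuous maps from the standard `n`-simplex to `X`. -/
abbrev SingularSimplex (X : Type u) [TopologicalSpace X] (n : ℕ) : Type u :=
  C(stdSimplex ℝ (Fin (n + 1)), X)

/-- The inclusion of the `i`-th face (opposite to the `i`-th vertex) of the standard simplex. -/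
def faceInclusion (n : ℕ) (i : Fin (n + 2)) :
    C(stdSimplex ℝ (Fin (n + 1)), stdSimplex ℝ (Fin (n + 2))) :=
  ⟨stdSimplex.map i.succAbove, stdSimplex.continuous_map _⟩

variable (R : Type w) [CommRing R]

/-- Singular `n`-cochains of `X` with coefficients in `R`: linear functionals on singular chains,
that is, arbitrary `R`-valued functions of singular simplices. -/
abbrev SingularCochain (X : Type u) [TopologicalSpace X] (n : ℕ) : Type (max u w) :=
  SingularSimplex X n → R

/-- The singular coboundary `(δφ)(s) = ∑ᵢ (-1)ⁱ φ(s ∘ dᵢ)`. -/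
def singularCoboundary (X : Type u) [TopologicalSpace X] (n : ℕ) :
    SingularCochain R X n →ₗ[R] SingularCochain R X (n + 1) where
  toFun φ s := ∑ i : Fin (n + 2), (-1 : R) ^ (i : ℕ) * φ (s.comp (faceInclusion n i))
  map_add' φ ψ := by
    ext s
    simp [mul_add, Finset.sum_add_distrib]
  map_smul' c φ := by
    ext s
    simp [Finset.mul_sum, mul_left_comm]

theorem singularCoboundary_comp (X : Type u) [TopologicalSpace X] (n : ℕ)
    (φ : SingularCochain R X n) :
    singularCoboundary R X (n + 1) (singularCoboundary R X n φ) = 0 := by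
  ext s
  simp only [singularCoboundary, LinearMap.coe_mk, AddHom.coe_mk, Finset.mul_sum, Pi.zero_apply]
  rw [← Fintype.sum_prod_type']
  refine Finset.sum_involution (fun p _ => (p.1.succAbove p.2, p.2.predAbove p.1)) ?_ ?_ ?_ ?_
  · rintro ⟨i, j⟩ -
    have h : (s.comp (faceInclusion (n + 1) (i.succAbove j))).comp
        (faceInclusion n (j.predAbove i)) =
        (s.comp (faceInclusion (n + 1) i)).comp (faceInclusion n j) := by
      ext x
      simp only [ContinuousMap.comp_apply, faceInclusion, ContinuousMap.coe_mk,
        stdSimplex.map_comp_apply]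
      congr 2
      ext k : 1
      exact Fin.succAbove_succAbove_succAbove_predAbove i j k
    simp only [h, ← mul_assoc, ← pow_add]
    rw [Fin.neg_one_pow_succAbove_add_predAbove]
    ring
  · rintro ⟨i, j⟩ - - h
    exact Fin.succAbove_ne i j (congrArg Prod.fst h)
  · intros
    exact Finset.mem_univ _
  · rintro ⟨i, j⟩ -
    simp [Fin.succAbove_succAbove_predAbove, Fin.predAbove_predAbove_succAbove]

/-- The `n`-th singular cohomology `Hⁿ(X; R)`. -/
abbrev SingularCohomology (X : Type u) [TopologicalSpace X] (n : ℕ) : Type (max u w) :=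
  Cohomology (singularCoboundary R X) n

/-- Pullback of singular cochains along a continuous map. -/
def singularPullback {X : Type u} {Y : Type v} [TopologicalSpace X] [TopologicalSpace Y]
    (g : C(X, Y)) (n : ℕ) : SingularCochain R Y n →ₗ[R] SingularCochain R X n :=
  LinearMap.funLeft R R fun s => g.comp s

/-- The map `Hⁿ(Y; R) → Hⁿ(X; R)` induced by a continuous map `X → Y`. -/
def SingularCohomology.map {X : Type u} {Y : Type v} [TopologicalSpace X] [TopologicalSpace Y]
    (g : C(X, Y)) (n : ℕ) : SingularCohomology R Y n →ₗ[R] SingularCohomology R X n :=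
  Cohomology.map (singularCoboundary R Y) (singularCoboundary R X) (singularPullback R g)
    (fun _ _ => rfl) n

end Singular

/-! ### Cellular sheaves on simplicial complexes and their cohomology -/

section CellularSheaf

variable (R : Type*) [CommRing R] {ι : Type*}

/-- A cellular sheaf of `R`-modules on an abstract simplicial complex `K`: a module for every
simplex and a restriction map `F(σ) → F(τ)` for every face relation `σ ⊆ τ`, functorially. -/
structure CellularSheaf (K : PreAbstractSimplicialComplex ι) where
  obj : K → Type v
  [addCommGroup : ∀ σ, AddCommGroup (obj σ)]
  [module : ∀ σ, Module R (obj σ)]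
  map : ∀ {σ τ : K}, σ.1 ⊆ τ.1 → (obj σ →ₗ[R] obj τ)
  map_id : ∀ (σ : K) (x : obj σ), map (Finset.Subset.refl σ.1) x = x
  map_comp : ∀ {σ l τ : K} (h : σ.1 ⊆ l.1) (h' : l.1 ⊆ τ.1) (x : obj σ),
    map h' (map h x) = map (h.trans h') x

attribute [instance] CellularSheaf.addCommGroup CellularSheaf.module

variable {R}
variable {K : PreAbstractSimplicialComplex ι}

/-- The `n`-dimensional simplices of `K`: those with `n + 1` vertices. -/
abbrev NSimplex (K : PreAbstractSimplicialComplex ι) (n : ℕ) : Type _ :=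
  {σ : K // σ.1.card = n + 1}

/-- The facet of an `(n + 1)`-simplex opposite to its vertex `v`. -/
def NSimplex.facet [DecidableEq ι] {n : ℕ} (τ : NSimplex K (n + 1)) (v : τ.1.1) :
    NSimplex K n :=
  have hcard : (τ.1.1.erase v.1).card = n + 1 := by
    rw [Finset.card_erase_of_mem v.2, τ.2]
    rfl
  ⟨⟨τ.1.1.erase v.1, (K.isRelLowerSet_faces τ.1.2).2 (Finset.erase_subset _ _)
    (Finset.card_pos.1 (by omega))⟩, hcard⟩

theorem NSimplex.facet_subset [DecidableEq ι] {n : ℕ} (τ : NSimplex K (n + 1)) (v : τ.1.1) :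
    (τ.facet v).1.1 ⊆ τ.1.1 :=
  Finset.erase_subset _ _

/-- The incidence number `[τ ∖ {v} : τ]` for the orientation of simplices given by a linear order
on the vertices: `(-1)^p`, where `p` is the position of `v` in `τ`, counted from `0`. -/
def incidence [LinearOrder ι] (τ : Finset ι) (v : ι) : ℤ :=
  (-1) ^ (τ.filter (· < v)).card

/-- The `n`-cochains of `K` with values in `F`, one element of `F(σ)` for each `n`-simplex `σ`. -/
abbrev SheafCochain (F : CellularSheaf R K) (n : ℕ) : Type _ :=
  ∀ σ : NSimplex K n, F.obj σ.1

/-- The coboundary `(δφ)(τ) = ∑_σ [σ : τ] F_{στ}(φ(σ))`, the sum being over the facets `σ` of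
`τ`. -/
def sheafCoboundary [LinearOrder ι] (F : CellularSheaf R K) (n : ℕ) :
    SheafCochain F n →ₗ[R] SheafCochain F (n + 1) where
  toFun φ τ := ∑ v : τ.1.1, incidence τ.1.1 v.1 •
    F.map (τ.facet_subset v) (φ (τ.facet v))
  map_add' φ ψ := by
    ext τ
    simp [Finset.sum_add_distrib]
  map_smul' c φ := by
    ext τ
    simp only [Pi.smul_apply, map_smul, Finset.smul_sum, RingHom.id_apply]
    exact Finset.sum_congr rfl fun v _ => smul_comm _ _ _

theorem incidence_mul_add [LinearOrder ι] (τ : Finset ι) {a b : ι} (ha : a ∈ τ) (hb : b ∈ τ)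
    (hab : a ≠ b) :
    incidence τ a * incidence (τ.erase a) b + incidence τ b * incidence (τ.erase b) a = 0 := by
  have key : ∀ {a b : ι}, a ∈ τ → a < b →
      incidence τ a * incidence (τ.erase a) b + incidence τ b * incidence (τ.erase b) a = 0 := by
    intro a b ha h
    have h1 : ((τ.erase a).filter (· < b)).card + 1 = (τ.filter (· < b)).card := by
      rw [Finset.filter_erase]
      exact Finset.card_erase_add_one (Finset.mem_filter.2 ⟨ha, h⟩)
    have h2 : (τ.erase b).filter (· < a) = τ.filter (· < a) := by
      rw [Finset.filter_erase]
      exact Finset.erase_eq_of_notMem fun hm => (Finset.mem_filter.1 hm).2.not_gt h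
    simp only [incidence, h2, ← h1, pow_succ]
    ring
  rcases lt_or_gt_of_ne hab with h | h
  · exact key ha h
  · rw [add_comm]
    exact key hb h

theorem sheafCoboundary_comp [LinearOrder ι] (F : CellularSheaf R K) (n : ℕ)
    (φ : SheafCochain F n) :
    sheafCoboundary F (n + 1) (sheafCoboundary F n φ) = 0 := by
  classical
  have key : ∀ (τ : NSimplex K (n + 2)) (ρ ρ' : NSimplex K n) (_ : ρ = ρ')
      (h : ρ.1.1 ⊆ τ.1.1) (h' : ρ'.1.1 ⊆ τ.1.1),
      F.map (σ := ρ.1) (τ := τ.1) h (φ ρ) = F.map (σ := ρ'.1) (τ := τ.1) h' (φ ρ') := by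
    rintro τ ρ _ rfl h h'
    rfl
  ext τ
  simp only [sheafCoboundary, LinearMap.coe_mk, AddHom.coe_mk, map_sum, map_zsmul, F.map_comp,
    Finset.smul_sum, smul_smul, Pi.zero_apply]
  rw [Finset.sum_sigma']
  refine Finset.sum_involution (fun p _ => ⟨⟨p.2.1, Finset.mem_of_mem_erase p.2.2⟩,
    ⟨p.1.1, Finset.mem_erase.2 ⟨(Finset.ne_of_mem_erase p.2.2).symm, p.1.2⟩⟩⟩) ?_ ?_ ?_ ?_
  · rintro ⟨⟨a, ha⟩, ⟨b, hb⟩⟩ -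
    have hb' : b ≠ a := Finset.ne_of_mem_erase hb
    have hbτ : b ∈ τ.1.1 := Finset.mem_of_mem_erase hb
    rw [key τ (NSimplex.facet (τ.facet ⟨b, hbτ⟩) ⟨a, Finset.mem_erase.2 ⟨hb'.symm, ha⟩⟩)
      (NSimplex.facet (τ.facet ⟨a, ha⟩) ⟨b, hb⟩)
      (Subtype.ext (Subtype.ext Finset.erase_right_comm)) _
      ((NSimplex.facet_subset _ _).trans (NSimplex.facet_subset _ _)), ← add_smul]
    convert zero_smul ℤ _
    exact incidence_mul_add _ ha hbτ hb'.symm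
  · rintro ⟨⟨a, ha⟩, ⟨b, hb⟩⟩ - - h
    exact Finset.ne_of_mem_erase hb (congrArg (fun p => p.1.1) h)
  · intros
    simp
  · rintro ⟨⟨a, ha⟩, ⟨b, hb⟩⟩ -
    rfl

/-- The `n`-th cohomology `Hⁿ(K; F)` of `K` with coefficients in the cellular sheaf `F`. -/
abbrev SheafCohomology [LinearOrder ι] (F : CellularSheaf R K) (n : ℕ) : Type _ :=
  Cohomology (sheafCoboundary F) n

end CellularSheaf

/-! ### Nerves and Leray sheaves -/

section Leray

variable {ι : Type*} {Y : Type*}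

/-- The support `V_σ = ⋂_{i ∈ σ} V_i`. -/
def nerveSupport (V : ι → Set Y) (σ : Finset ι) : Set Y :=
  ⋂ i ∈ σ, V i

theorem nerveSupport_anti (V : ι → Set Y) {σ τ : Finset ι} (h : σ ⊆ τ) :
    nerveSupport V τ ⊆ nerveSupport V σ :=
  Set.biInter_subset_biInter_left h

/-- The nerve of a family of sets: the nonempty finite sets of indices with nonempty support. -/
def nerveComplex (V : ι → Set Y) : PreAbstractSimplicialComplex ι where
  faces := {σ | σ.Nonempty ∧ (nerveSupport V σ).Nonempty}
  isRelLowerSet_faces := fun _ h =>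
    ⟨h.1, fun _ hτ hne => ⟨hne, h.2.mono (nerveSupport_anti V hτ)⟩⟩

/-- The Leray cellular sheaf `Lⁿ(σ) = Hⁿ(f⁻¹(V_σ); R)` on the nerve of `V`, with restriction maps
induced by the inclusions `f⁻¹(V_τ) ⊆ f⁻¹(V_σ)` for `σ ⊆ τ`. -/
def leraySheaf (R : Type w) [CommRing R] {X : Type u} [TopologicalSpace X] (f : X → Y)
    (V : ι → Set Y) (n : ℕ) : CellularSheaf.{max u w} R (nerveComplex V) where
  obj σ := SingularCohomology R (f ⁻¹' nerveSupport V σ.1) n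
  map h := SingularCohomology.map R
    (ContinuousMap.inclusion (Set.preimage_mono (nerveSupport_anti V h))) n
  map_id σ x := by
    obtain ⟨x, rfl⟩ := Submodule.Quotient.mk_surjective _ x
    rfl
  map_comp h h' x := by
    obtain ⟨x, rfl⟩ := Submodule.Quotient.mk_surjective _ x
    rfl

end Leray

end

/-! Write U_σ = f⁻¹(V_σ). The theorem is Mayer–Vietoris for the cover of X by the sets U_i. Singular
cochains form a sequence Cⁿ(X) → ∏ Cⁿ(U_i) → ∏ Cⁿ(U_τ), with i running over the vertices and τ over
the edges of the nerve.

It is exact in the middle, because families that agree on overlaps glue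
(`exists_restrictVertices_eq`). The second map is onto because the nerve has no triangles: supports
of distinct edges are disjoint, so cochains on the edges extend by zero independently of each other
(`sheafCoboundary_cochainSheaf_surjective`). The kernel of the first map consists of the cochains
vanishing on simplices that lie in some U_i. It is acyclic by barycentric subdivision
(`exists_primitive_of_vanishes_on_small`).

A diagram chase then studies the restriction Hⁿ(X) → ∏ Hⁿ(U_i). Its range is the kernel of the Leray
coboundary, that is H⁰(N; Lⁿ) (`range_cohomologyRestriction`). In degree 0 it is injective. In
degree n + 1 its kernel consists of classes of cocycles a with a = d c_i on each U_i; the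
differences of the c_i on the edges are cocycles, and this identifies the kernel with H¹(N; Lⁿ)
(`nonempty_ker_cohomologyRestriction_equiv`). Over a field, a vector space is the sum of the range
and the kernel of a linear map.

Subdivision is carried out on functions of tuples of points, where it is pure combinatorics, and is
transferred to singular cochains by evaluating them on affine simplices. -/

noncomputable section

/-! ### Barycentric subdivision of ordered cochains -/

section OrderedCochain

variable (R : Type*) [CommRing R] {E F : Type*}

/-- Ordered `n`-cochains on a set `E`: functions of `(n + 1)`-tuples of points of `E`. -/
abbrev OrderedCochain (E : Type*) (n : ℕ) : Type _ :=
  (Fin (n + 1) → E) → R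

/-- The coboundary `(δφ)(v) = ∑ᵢ (-1)ⁱ φ(v ∘ dᵢ)` of ordered cochains. -/
def orderedCoboundary (E : Type*) (n : ℕ) : OrderedCochain R E n →ₗ[R] OrderedCochain R E (n + 1) :=
  LinearMap.pi fun v => ∑ i : Fin (n + 2), (-1 : R) ^ (i : ℕ) • LinearMap.proj (v ∘ i.succAbove)

variable {R}

theorem orderedCoboundary_apply (n : ℕ) (φ : OrderedCochain R E n) (v : Fin (n + 2) → E) :
    orderedCoboundary R E n φ v =
      ∑ i : Fin (n + 2), (-1 : R) ^ (i : ℕ) * φ (v ∘ i.succAbove) := by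
  simp [orderedCoboundary]

theorem orderedCoboundary_comp (n : ℕ) (φ : OrderedCochain R E n) :
    orderedCoboundary R E (n + 1) (orderedCoboundary R E n φ) = 0 := by
  ext v
  simp only [orderedCoboundary_apply, Finset.mul_sum, Pi.zero_apply]
  rw [← Fintype.sum_prod_type']
  refine Finset.sum_involution (fun p _ => (p.1.succAbove p.2, p.2.predAbove p.1)) ?_ ?_ ?_ ?_
  · rintro ⟨i, j⟩ -
    have h : (v ∘ (i.succAbove j).succAbove) ∘ (j.predAbove i).succAbove =
        (v ∘ i.succAbove) ∘ j.succAbove := by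
      funext k
      exact congrArg v (Fin.succAbove_succAbove_succAbove_predAbove i j k)
    simp only [h, ← mul_assoc, ← pow_add]
    rw [Fin.neg_one_pow_succAbove_add_predAbove]
    ring
  · rintro ⟨i, j⟩ - - h
    exact Fin.succAbove_ne i j (congrArg Prod.fst h)
  · intros
    exact Finset.mem_univ _
  · rintro ⟨i, j⟩ -
    simp [Fin.succAbove_succAbove_predAbove, Fin.predAbove_predAbove_succAbove]

variable (R) in
/-- Precomposition with the cone operator `w ↦ (b, w)`. -/
def coneCochain (b : E) (n : ℕ) : OrderedCochain R E (n + 1) →ₗ[R] OrderedCochain R E n :=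
  LinearMap.funLeft R R fun w => (Fin.cons b w : Fin (n + 2) → E)

theorem coneCochain_apply (b : E) (n : ℕ) (φ : OrderedCochain R E (n + 1)) (w : Fin (n + 1) → E) :
    coneCochain R b n φ w = φ (Fin.cons b w : Fin (n + 2) → E) :=
  rfl

/-- Dual to ∂(b * w) = w - b * ∂w: the face opposite the apex is w, and every other face is a cone
over a face of w, with its sign shifted by one. -/
theorem coneCochain_orderedCoboundary (b : E) (n : ℕ) (φ : OrderedCochain R E (n + 1)) :
    coneCochain R b (n + 1) (orderedCoboundary R E (n + 1) φ) =
      φ - orderedCoboundary R E n (coneCochain R b n φ) := by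
  ext w
  have h0 : (Fin.cons b w : Fin (n + 3) → E) ∘ (0 : Fin (n + 3)).succAbove = w := by
    funext k
    simp
  have hs : ∀ i : Fin (n + 2), (Fin.cons b w : Fin (n + 3) → E) ∘ i.succ.succAbove =
      (Fin.cons b (w ∘ i.succAbove) : Fin (n + 2) → E) := by
    intro i
    funext k
    cases k using Fin.cases with
    | zero => simp
    | succ k => simp
  rw [coneCochain_apply, orderedCoboundary_apply, Fin.sum_univ_succ, Pi.sub_apply,
    orderedCoboundary_apply, h0]
  simp only [hs, coneCochain_apply, Fin.val_succ, pow_succ, Fin.val_zero, pow_zero, one_mul,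
    mul_neg, mul_one, neg_mul, Finset.sum_neg_distrib]
  ring

variable (R) in
/-- The barycentric subdivision operator on ordered cochains, where `β` assigns to a tuple its
barycenter: the dual of `v ↦ β(v) * Sd(∂v)`. -/
def subdivision (β : ∀ n, (Fin (n + 1) → E) → E) :
    ∀ n, OrderedCochain R E n →ₗ[R] OrderedCochain R E n
  | 0 => LinearMap.id
  | n + 1 => LinearMap.pi fun v => LinearMap.proj v ∘ₗ orderedCoboundary R E n ∘ₗ
      subdivision β n ∘ₗ coneCochain R (β (n + 1) v) n

variable (R) in
/-- The homotopy from the identity to the subdivision: the dual of `v ↦ β(v) * (v - T(∂v))`. -/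
def subdivisionHomotopy (β : ∀ n, (Fin (n + 1) → E) → E) :
    ∀ n, OrderedCochain R E (n + 1) →ₗ[R] OrderedCochain R E n
  | 0 => 0
  | n + 1 => LinearMap.pi fun v => LinearMap.proj v ∘ₗ
      (coneCochain R (β (n + 1) v) (n + 1) - orderedCoboundary R E n ∘ₗ
        subdivisionHomotopy β n ∘ₗ coneCochain R (β (n + 1) v) (n + 1))

/-! ### The homotopy between subdivision and the identity -/

section Homotopy

variable (β : ∀ n, (Fin (n + 1) → E) → E)

theorem subdivision_succ_apply (n : ℕ) (φ : OrderedCochain R E (n + 1)) (v : Fin (n + 2) → E) :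
    subdivision R β (n + 1) φ v =
      orderedCoboundary R E n (subdivision R β n (coneCochain R (β (n + 1) v) n φ)) v :=
  rfl

theorem subdivisionHomotopy_succ_apply (n : ℕ) (φ : OrderedCochain R E (n + 2))
    (v : Fin (n + 2) → E) :
    subdivisionHomotopy R β (n + 1) φ v = coneCochain R (β (n + 1) v) (n + 1) φ v -
      orderedCoboundary R E n
        (subdivisionHomotopy R β n (coneCochain R (β (n + 1) v) (n + 1) φ)) v :=
  rfl

/-- The inductive step of the homotopy formula. It needs the formula one degree lower only after a
coboundary is applied, where the term δ(δT) drops out; this form also makes sense in degree 0, where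
T = 0 and Sd = 1. -/
theorem subdivisionHomotopy_succ_of_coboundary (n : ℕ)
    (h : ∀ χ : OrderedCochain R E n,
      orderedCoboundary R E n (subdivisionHomotopy R β n (orderedCoboundary R E n χ)) =
        orderedCoboundary R E n χ - orderedCoboundary R E n (subdivision R β n χ))
    (φ : OrderedCochain R E (n + 1)) :
    subdivisionHomotopy R β (n + 1) (orderedCoboundary R E (n + 1) φ) +
      orderedCoboundary R E n (subdivisionHomotopy R β n φ) =
        φ - subdivision R β (n + 1) φ := by
  ext v
  rw [Pi.add_apply, Pi.sub_apply, subdivisionHomotopy_succ_apply, coneCochain_orderedCoboundary,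
    map_sub, map_sub, h, subdivision_succ_apply]
  simp only [Pi.sub_apply]
  ring

theorem orderedCoboundary_subdivisionHomotopy_orderedCoboundary (n : ℕ)
    (χ : OrderedCochain R E n) :
    orderedCoboundary R E n (subdivisionHomotopy R β n (orderedCoboundary R E n χ)) =
      orderedCoboundary R E n χ - orderedCoboundary R E n (subdivision R β n χ) := by
  induction n with
  | zero => simp [subdivisionHomotopy, subdivision]
  | succ n ih =>
    have h := congrArg (orderedCoboundary R E (n + 1))
      (subdivisionHomotopy_succ_of_coboundary β n ih χ)
    rwa [map_add, orderedCoboundary_comp, add_zero, map_sub] at h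

/-- The subdivision operator is homotopic to the identity. -/
theorem subdivisionHomotopy_add (n : ℕ) (φ : OrderedCochain R E (n + 1)) :
    subdivisionHomotopy R β (n + 1) (orderedCoboundary R E (n + 1) φ) +
      orderedCoboundary R E n (subdivisionHomotopy R β n φ) =
        φ - subdivision R β (n + 1) φ :=
  subdivisionHomotopy_succ_of_coboundary β n
    (orderedCoboundary_subdivisionHomotopy_orderedCoboundary β n) φ

variable (R) in
/-- The homotopy from the identity to the `k`-fold subdivision. -/
def iteratedHomotopy (k n : ℕ) : OrderedCochain R E (n + 1) →ₗ[R] OrderedCochain R E n :=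
  ∑ j ∈ Finset.range k, subdivisionHomotopy R β n ∘ₗ subdivision R β (n + 1) ^ j

theorem iteratedHomotopy_apply (k n : ℕ) (φ : OrderedCochain R E (n + 1)) :
    iteratedHomotopy R β k n φ =
      ∑ j ∈ Finset.range k, subdivisionHomotopy R β n ((subdivision R β (n + 1) ^ j) φ) := by
  simp [iteratedHomotopy]

/-- On a cocycle the homotopy formula reads δT = 1 - Sd; applied to the successive subdivisions,
which are again cocycles, it telescopes. -/
theorem orderedCoboundary_iteratedHomotopy (k n : ℕ) (φ : OrderedCochain R E (n + 1))
    (hφ : orderedCoboundary R E (n + 1) φ = 0) :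
    orderedCoboundary R E n (iteratedHomotopy R β k n φ) =
      φ - (subdivision R β (n + 1) ^ k) φ := by
  have hcocycle : ∀ j, orderedCoboundary R E (n + 1) ((subdivision R β (n + 1) ^ j) φ) = 0 := by
    intro j
    induction j with
    | zero => simpa using hφ
    | succ j ih =>
      have h := orderedCoboundary_subdivisionHomotopy_orderedCoboundary β (n + 1)
        ((subdivision R β (n + 1) ^ j) φ)
      rw [ih, map_zero, map_zero, zero_sub, eq_comm, neg_eq_zero] at h
      rwa [pow_succ', Module.End.mul_apply]
  have hstep : ∀ j, orderedCoboundary R E n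
      (subdivisionHomotopy R β n ((subdivision R β (n + 1) ^ j) φ)) =
      (subdivision R β (n + 1) ^ j) φ - (subdivision R β (n + 1) ^ (j + 1)) φ := by
    intro j
    have h := subdivisionHomotopy_add β n ((subdivision R β (n + 1) ^ j) φ)
    rw [hcocycle, map_zero, zero_add] at h
    rw [h, pow_succ', Module.End.mul_apply]
  rw [iteratedHomotopy_apply, map_sum]
  simp only [hstep]
  rw [Finset.sum_range_sub', pow_zero, Module.End.one_apply]

end Homotopy

/-! ### Naturality under maps that preserve barycenters, such as face inclusions -/

section Naturality

variable (g : E → F)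

variable (R) in
/-- Pullback of ordered cochains along a map. -/
def orderedPullback (n : ℕ) : OrderedCochain R F n →ₗ[R] OrderedCochain R E n :=
  LinearMap.funLeft R R fun v => g ∘ v

theorem orderedPullback_apply (n : ℕ) (φ : OrderedCochain R F n) (v : Fin (n + 1) → E) :
    orderedPullback R g n φ v = φ (g ∘ v) :=
  rfl

theorem orderedCoboundary_orderedPullback (n : ℕ) (φ : OrderedCochain R F n) :
    orderedCoboundary R E n (orderedPullback R g n φ) =
      orderedPullback R g (n + 1) (orderedCoboundary R F n φ) := by
  ext v
  simp only [orderedCoboundary_apply, orderedPullback_apply, Function.comp_assoc]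

theorem coneCochain_orderedPullback (b : E) (n : ℕ) (φ : OrderedCochain R F (n + 1)) :
    coneCochain R b n (orderedPullback R g (n + 1) φ) =
      orderedPullback R g n (coneCochain R (g b) n φ) := by
  ext v
  simp only [coneCochain_apply, orderedPullback_apply]
  congr 1
  funext k
  cases k using Fin.cases <;> simp

variable (β : ∀ n, (Fin (n + 1) → E) → E) (γ : ∀ n, (Fin (n + 1) → F) → F)

theorem subdivision_orderedPullback
    (hg : ∀ n v, g (β n v) = γ n (g ∘ v)) (n : ℕ) (φ : OrderedCochain R F n) :
    subdivision R β n (orderedPullback R g n φ) =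
      orderedPullback R g n (subdivision R γ n φ) := by
  induction n with
  | zero => rfl
  | succ n ih =>
    ext v
    rw [subdivision_succ_apply, coneCochain_orderedPullback, ih,
      orderedCoboundary_orderedPullback, hg]
    rfl

theorem subdivisionHomotopy_orderedPullback
    (hg : ∀ n v, g (β n v) = γ n (g ∘ v)) (n : ℕ) (φ : OrderedCochain R F (n + 1)) :
    subdivisionHomotopy R β n (orderedPullback R g (n + 1) φ) =
      orderedPullback R g n (subdivisionHomotopy R γ n φ) := by
  induction n with
  | zero => rfl
  | succ n ih =>
    ext v
    rw [subdivisionHomotopy_succ_apply, coneCochain_orderedPullback, ih,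
      orderedCoboundary_orderedPullback, hg]
    rfl

theorem iteratedHomotopy_orderedPullback
    (hg : ∀ n v, g (β n v) = γ n (g ∘ v)) (k n : ℕ) (φ : OrderedCochain R F (n + 1)) :
    iteratedHomotopy R β k n (orderedPullback R g (n + 1) φ) =
      orderedPullback R g n (iteratedHomotopy R γ k n φ) := by
  have hpow : ∀ j, (subdivision R β (n + 1) ^ j) (orderedPullback R g (n + 1) φ) =
      orderedPullback R g (n + 1) ((subdivision R γ (n + 1) ^ j) φ) := by
    intro j
    induction j with
    | zero => rfl
    | succ j ih =>
      rw [pow_succ', Module.End.mul_apply, ih, subdivision_orderedPullback g β γ hg, pow_succ',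
        Module.End.mul_apply]
  simp only [iteratedHomotopy_apply, map_sum, hpow, subdivisionHomotopy_orderedPullback g β γ hg]

end Naturality

/-! ### Mesh estimates, in dual form -/

section Diameter

variable [PseudoMetricSpace E]

/-- The cochain `φ` vanishes on tuples in `S` whose points have mutual distances at most `r`. -/
def VanishesOnFine {n : ℕ} (φ : OrderedCochain R E n) (S : Set E) (r : ℝ) : Prop :=
  ∀ w : Fin (n + 1) → E, (∀ i, w i ∈ S) → (∀ i j, dist (w i) (w j) ≤ r) → φ w = 0

theorem VanishesOnFine.orderedCoboundary {n : ℕ} {φ : OrderedCochain R E n} {S : Set E} {r : ℝ}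
    (h : VanishesOnFine φ S r) : VanishesOnFine (orderedCoboundary R E n φ) S r := by
  intro w hw hr
  rw [orderedCoboundary_apply]
  refine Finset.sum_eq_zero fun i _ => ?_
  rw [h (w ∘ i.succAbove) (fun k => hw _) (fun k l => hr _ _), mul_zero]

theorem dist_cons_le {n : ℕ} {b : E} {w : Fin (n + 1) → E} {r : ℝ}
    (hb : ∀ i, dist (w i) b ≤ r) (hw : ∀ i j, dist (w i) (w j) ≤ r) (i j : Fin (n + 2)) :
    dist ((Fin.cons b w : Fin (n + 2) → E) i) ((Fin.cons b w : Fin (n + 2) → E) j) ≤ r := by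
  have hr : 0 ≤ r := dist_nonneg.trans (hb 0)
  cases i using Fin.cases <;> cases j using Fin.cases <;> simp only [Fin.cons_zero, Fin.cons_succ]
  · simpa using hr
  · rw [dist_comm]
    exact hb _
  · exact hb _
  · exact hw _ _

variable (β : ∀ n, (Fin (n + 1) → E) → E)

/-- A barycenter operator for which balls are convex and which is as close to the points as the
barycenter in a normed space. -/
structure IsBarycentric : Prop where
  dist_le : ∀ n (w : Fin (n + 1) → E) (x : E) (r : ℝ),
    (∀ i, dist (w i) x ≤ r) → dist (β n w) x ≤ r
  dist_le_mul : ∀ n (w : Fin (n + 1) → E) (r : ℝ), (∀ i j, dist (w i) (w j) ≤ r) →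
    ∀ j, dist (w j) (β n w) ≤ (n / (n + 1) : ℝ) * r

/-- A set stable under taking barycenters. -/
def IsBarycenterStable (S : Set E) : Prop :=
  ∀ n (w : Fin (n + 1) → E), (∀ i, w i ∈ S) → β n w ∈ S

variable {β}

/-- Balls are the domains to which the inductions below retreat: a coned cochain is controlled only
on tuples close to the apex. -/
theorem IsBarycenterStable.inter_closedBall (hβ : IsBarycentric β) {S : Set E}
    (hS : IsBarycenterStable β S) (x : E) (r : ℝ) :
    IsBarycenterStable β (S ∩ Metric.closedBall x r) :=
  fun n w hw => ⟨hS n w fun i => (hw i).1, hβ.dist_le n w x r fun i => (hw i).2⟩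

theorem div_succ_mul_le_mul (n : ℕ) {r : ℝ} (hr : 0 ≤ r) :
    (n / (n + 1) : ℝ) * r ≤ ((n + 1 : ℕ) / ((n + 1 : ℕ) + 1) : ℝ) * r := by
  refine mul_le_mul_of_nonneg_right ?_ hr
  rw [div_le_div_iff₀ (by positivity) (by positivity)]
  push_cast
  nlinarith

theorem div_succ_mul_le (n : ℕ) {r : ℝ} (hr : 0 ≤ r) : (n / (n + 1) : ℝ) * r ≤ r := by
  refine mul_le_of_le_one_left hr ?_
  rw [div_le_one (by positivity)]
  linarith

/-- Subdividing shrinks an `n`-simplex by a factor of `n / (n + 1)`. -/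
theorem VanishesOnFine.subdivision (hβ : IsBarycentric β) {n : ℕ} {φ : OrderedCochain R E n}
    {S : Set E} (hS : IsBarycenterStable β S) {r : ℝ}
    (h : VanishesOnFine φ S ((n / (n + 1) : ℝ) * r)) :
    VanishesOnFine (subdivision R β n φ) S r := by
  induction n generalizing S with
  | zero =>
    intro v hv _
    -- For n = 0 the factor n / (n + 1) is 0, and a one-point tuple has diameter 0.
    refine h v hv fun i j => ?_
    rw [Fin.ext (by omega : (i : ℕ) = j)]
    simp
  | succ n ih =>
    intro v hv hr
    have hr0 : 0 ≤ r := dist_nonneg.trans (hr 0 0)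
    rw [subdivision_succ_apply]
    -- The ball about the barycenter has radius (n + 1) / (n + 2) * r and contains all the `v i`.
    -- Coning a tuple of this ball from its centre creates no distance larger than that radius.
    refine VanishesOnFine.orderedCoboundary (ih (hS.inter_closedBall hβ (β (n + 1) v) _) ?_)
      v (fun i => ⟨hv i, hβ.dist_le_mul (n + 1) v r hr i⟩) hr
    intro w hw hwr
    refine h _ (fun i => ?_) (dist_cons_le (fun i => (hw i).2)
      fun i j => (hwr i j).trans (div_succ_mul_le_mul n hr0))
    cases i using Fin.cases
    · exact hS _ _ hv
    · exact (hw _).1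

/-- The homotopy only cones from barycenters, which lie within r of the vertices, so it never
produces tuples of larger diameter. Hence there is no factor here. -/
theorem VanishesOnFine.subdivisionHomotopy (hβ : IsBarycentric β) {n : ℕ}
    {φ : OrderedCochain R E (n + 1)} {S : Set E} (hS : IsBarycenterStable β S) {r : ℝ}
    (h : VanishesOnFine φ S r) : VanishesOnFine (subdivisionHomotopy R β n φ) S r := by
  induction n generalizing S with
  | zero =>
    intro v _ _
    rfl
  | succ n ih =>
    intro v hv hr
    have hr0 : 0 ≤ r := dist_nonneg.trans (hr 0 0)
    have hball : ∀ i, dist (v i) (β (n + 1) v) ≤ r := fun i =>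
      (hβ.dist_le_mul (n + 1) v r hr i).trans (div_succ_mul_le _ hr0)
    have hcone : VanishesOnFine (coneCochain R (β (n + 1) v) (n + 1) φ)
        (S ∩ Metric.closedBall (β (n + 1) v) r) r := by
      intro w hw hwr
      refine h _ (fun i => ?_) (dist_cons_le (fun i => (hw i).2) hwr)
      cases i using Fin.cases
      · exact hS _ _ hv
      · exact (hw _).1
    have hv' : ∀ i, v i ∈ S ∩ Metric.closedBall (β (n + 1) v) r := fun i => ⟨hv i, hball i⟩
    rw [subdivisionHomotopy_succ_apply, hcone v hv' hr,
      (ih (hS.inter_closedBall hβ _ _) hcone).orderedCoboundary v hv' hr, sub_zero]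

theorem VanishesOnFine.subdivision_pow (hβ : IsBarycentric β) {n : ℕ} {φ : OrderedCochain R E n}
    {S : Set E} (hS : IsBarycenterStable β S) (k : ℕ) {r : ℝ}
    (h : VanishesOnFine φ S ((n / (n + 1) : ℝ) ^ k * r)) :
    VanishesOnFine ((_root_.subdivision R β n ^ k) φ) S r := by
  induction k generalizing r with
  | zero => simpa using h
  | succ k ih =>
    rw [pow_succ', Module.End.mul_apply]
    refine VanishesOnFine.subdivision hβ hS (ih ?_)
    rwa [← mul_assoc, ← pow_succ]

end Diameter

end OrderedCochain

end

noncomputable section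

/-! ### Affine simplices -/

section AffineSimplex

variable {k n m : ℕ}

/-- The affine singular simplex of a standard simplex with given vertices. -/
def affineSimplex (w : Fin (n + 1) → stdSimplex ℝ (Fin (m + 1))) :
    C(stdSimplex ℝ (Fin (n + 1)), stdSimplex ℝ (Fin (m + 1))) where
  toFun t := ⟨∑ i, t i • (w i : Fin (m + 1) → ℝ),
    (convex_stdSimplex ℝ _).sum_mem (fun i _ => t.2.1 i) t.2.2 fun i _ => (w i).2⟩
  continuous_toFun := by
    refine Continuous.subtype_mk (continuous_finsetSum _ fun i _ => ?_) _
    exact ((continuous_apply i).comp continuous_subtype_val).smul continuous_const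

theorem coe_affineSimplex (w : Fin (n + 1) → stdSimplex ℝ (Fin (m + 1)))
    (t : stdSimplex ℝ (Fin (n + 1))) :
    (affineSimplex w t).1 = ∑ i, t.1 i • (w i).1 :=
  rfl

theorem affineSimplex_vertex :
    affineSimplex (stdSimplex.vertex : Fin (n + 1) → stdSimplex ℝ (Fin (n + 1))) =
      ContinuousMap.id _ := by
  refine ContinuousMap.ext fun t => Subtype.ext ?_
  rw [coe_affineSimplex]
  funext j
  simp [Finset.sum_apply, Pi.single_apply]

theorem affineSimplex_map (w : Fin (n + 1) → stdSimplex ℝ (Fin (m + 1)))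
    (g : Fin (k + 1) → Fin (n + 1)) (t : stdSimplex ℝ (Fin (k + 1))) :
    affineSimplex w (stdSimplex.map g t) = affineSimplex (w ∘ g) t := by
  refine Subtype.ext ?_
  rw [coe_affineSimplex, coe_affineSimplex]
  have h : ∀ j, (stdSimplex.map g t).1 j = ∑ i with g i = j, t.1 i := fun j =>
    FunOnFinite.linearMap_apply_apply ℝ ℝ g t.1 j
  simp only [h, Finset.sum_smul]
  rw [← Finset.sum_fiberwise Finset.univ g]
  refine Finset.sum_congr rfl fun j _ => Finset.sum_congr rfl fun i hi => ?_
  rw [Function.comp_apply, (Finset.mem_filter.1 hi).2]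

theorem affineSimplex_comp_faceInclusion (w : Fin (n + 2) → stdSimplex ℝ (Fin (m + 1)))
    (i : Fin (n + 2)) :
    (affineSimplex w).comp (faceInclusion n i) = affineSimplex (w ∘ i.succAbove) :=
  ContinuousMap.ext fun t => affineSimplex_map w _ t

theorem faceInclusion_eq_affineSimplex (i : Fin (n + 2)) :
    faceInclusion n i = affineSimplex (stdSimplex.vertex ∘ i.succAbove) := by
  rw [← affineSimplex_comp_faceInclusion, affineSimplex_vertex, ContinuousMap.id_comp]

theorem affineSimplex_affineSimplex (u : Fin (n + 1) → stdSimplex ℝ (Fin (m + 1)))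
    (w : Fin (k + 1) → stdSimplex ℝ (Fin (n + 1))) (t : stdSimplex ℝ (Fin (k + 1))) :
    affineSimplex u (affineSimplex w t) = affineSimplex (affineSimplex u ∘ w) t := by
  refine Subtype.ext ?_
  simp only [coe_affineSimplex, Function.comp_apply, Finset.sum_apply, Pi.smul_apply,
    Finset.smul_sum, Finset.sum_smul, smul_smul, smul_eq_mul]
  exact Finset.sum_comm

/-- The barycenter of a tuple of points of a standard simplex. -/
def simplexBarycenter (m n : ℕ) (w : Fin (n + 1) → stdSimplex ℝ (Fin (m + 1))) :
    stdSimplex ℝ (Fin (m + 1)) :=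
  affineSimplex w stdSimplex.barycenter

theorem faceInclusion_simplexBarycenter (i : Fin (m + 2))
    (w : Fin (n + 1) → stdSimplex ℝ (Fin (m + 1))) :
    faceInclusion m i (simplexBarycenter m n w) =
      simplexBarycenter (m + 1) n (faceInclusion m i ∘ w) := by
  rw [simplexBarycenter, faceInclusion_eq_affineSimplex, affineSimplex_affineSimplex,
    simplexBarycenter]

theorem dist_affineSimplex_le (w : Fin (n + 1) → stdSimplex ℝ (Fin (m + 1)))
    (x : stdSimplex ℝ (Fin (m + 1))) {r : ℝ} (h : ∀ i, dist (w i) x ≤ r)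
    (t : stdSimplex ℝ (Fin (n + 1))) : dist (affineSimplex w t) x ≤ r := by
  have := (convex_closedBall x.1 r).sum_mem (t := Finset.univ) (w := t.1)
    (z := fun i => (w i).1) (fun i _ => t.2.1 i) t.2.2 fun i _ => h i
  exact this

theorem isBarycentric_simplexBarycenter : IsBarycentric (simplexBarycenter m) where
  dist_le n w x r h := dist_affineSimplex_le w x h _
  dist_le_mul n w r h j := by
    have hr : 0 ≤ r := dist_nonneg.trans (h j j)
    have hb : (simplexBarycenter m n w).1 = (n + 1 : ℝ)⁻¹ • ∑ i, (w i).1 := by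
      rw [simplexBarycenter, coe_affineSimplex, Finset.smul_sum]
      simp
    -- The term i = j of the average vanishes; the n remaining differences give the factor n / (n +
    -- 1).
    have hsum : (w j).1 - (simplexBarycenter m n w).1 =
        (n + 1 : ℝ)⁻¹ • ∑ i ∈ Finset.univ.erase j, ((w j).1 - (w i).1) := by
      have h1 : ∑ i ∈ Finset.univ.erase j, ((w j).1 - (w i).1) = ∑ i, ((w j).1 - (w i).1) :=
        Finset.sum_erase _ (sub_self _)
      rw [h1, Finset.sum_sub_distrib, hb, smul_sub, Finset.sum_const, Finset.card_univ,
        Fintype.card_fin, ← Nat.cast_smul_eq_nsmul ℝ, smul_smul]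
      push_cast
      rw [inv_mul_cancel₀ (by positivity), one_smul]
    have hnorm : ‖∑ i ∈ Finset.univ.erase j, ((w j).1 - (w i).1)‖ ≤ n * r := by
      refine (norm_sum_le_of_le _ fun i _ => (?_ : _ ≤ r)).trans_eq ?_
      · rw [← dist_eq_norm]
        exact h j i
      · rw [Finset.sum_const, Finset.card_erase_of_mem (Finset.mem_univ _), Finset.card_univ,
          Fintype.card_fin, nsmul_eq_mul, Nat.add_sub_cancel]
    calc dist (w j) (simplexBarycenter m n w)
        = ‖(w j).1 - (simplexBarycenter m n w).1‖ := dist_eq_norm (w j).1 _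
      _ ≤ (n + 1 : ℝ)⁻¹ * (n * r) := by
        rw [hsum, norm_smul, Real.norm_of_nonneg (by positivity)]
        gcongr
      _ = n / (n + 1) * r := by ring

theorem dist_stdSimplex_le_one (x y : stdSimplex ℝ (Fin (m + 1))) : dist x y ≤ 1 :=
  (Metric.dist_le_diam_of_mem (bounded_stdSimplex _) x.2 y.2).trans diam_stdSimplex_le

end AffineSimplex

/-! ### Cochains vanishing on small simplices -/

section Small

variable {R : Type*} [CommRing R] {X : Type*} [TopologicalSpace X] {ι : Type*}

variable (R) in
/-- Evaluation of singular cochains on the affine simplices of a singular simplex. -/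
def evalAffine {m : ℕ} (s : SingularSimplex X m) (n : ℕ) :
    SingularCochain R X n →ₗ[R] OrderedCochain R (stdSimplex ℝ (Fin (m + 1))) n :=
  LinearMap.funLeft R R fun w => s.comp (affineSimplex w)

theorem evalAffine_apply {m : ℕ} (s : SingularSimplex X m) (n : ℕ) (φ : SingularCochain R X n)
    (w : Fin (n + 1) → stdSimplex ℝ (Fin (m + 1))) :
    evalAffine R s n φ w = φ (s.comp (affineSimplex w)) :=
  rfl

/-- The way back from ordered to singular cochains. -/
theorem evalAffine_vertex {n : ℕ} (s : SingularSimplex X n) (φ : SingularCochain R X n) :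
    evalAffine R s n φ stdSimplex.vertex = φ s := by
  rw [evalAffine_apply, affineSimplex_vertex, ContinuousMap.comp_id]

theorem orderedCoboundary_evalAffine {m : ℕ} (s : SingularSimplex X m) (n : ℕ)
    (φ : SingularCochain R X n) :
    orderedCoboundary R _ n (evalAffine R s n φ) =
      evalAffine R s (n + 1) (singularCoboundary R X n φ) := by
  ext w
  simp only [orderedCoboundary_apply, evalAffine_apply, singularCoboundary, LinearMap.coe_mk,
    AddHom.coe_mk, ContinuousMap.comp_assoc, affineSimplex_comp_faceInclusion]

theorem evalAffine_comp_faceInclusion {m : ℕ} (s : SingularSimplex X (m + 1)) (i : Fin (m + 2))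
    (n : ℕ) (φ : SingularCochain R X n) :
    evalAffine R (s.comp (faceInclusion m i)) n φ =
      orderedPullback R (faceInclusion m i) n (evalAffine R s n φ) := by
  ext w
  rw [orderedPullback_apply, evalAffine_apply, evalAffine_apply]
  congr 1
  refine ContinuousMap.ext fun t => congrArg s ?_
  rw [faceInclusion_eq_affineSimplex]
  exact affineSimplex_affineSimplex _ _ _

/-- A singular simplex is small for a family of sets if it lies in one of them. -/
def IsSmallSimplex (U : ι → Set X) {n : ℕ} (s : SingularSimplex X n) : Prop :=
  ∃ i, ∀ t, s t ∈ U i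

variable {U : ι → Set X}

theorem IsSmallSimplex.vanishesOnFine {m n : ℕ} {s : SingularSimplex X m}
    (hs : IsSmallSimplex U s) {φ : SingularCochain R X n}
    (hφ : ∀ s, IsSmallSimplex U s → φ s = 0) (r : ℝ) :
    VanishesOnFine (evalAffine R s n φ) Set.univ r := by
  intro w _ _
  obtain ⟨i, hi⟩ := hs
  exact hφ _ ⟨i, fun t => hi _⟩

/-- Lebesgue number of the pulled-back cover, combined with the convexity of balls. -/
theorem exists_vanishesOnFine (hU : ∀ i, IsOpen (U i)) (hcover : ∀ x, ∃ i, x ∈ U i) {m n : ℕ}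
    (s : SingularSimplex X m) {φ : SingularCochain R X n}
    (hφ : ∀ s, IsSmallSimplex U s → φ s = 0) :
    ∃ r > 0, VanishesOnFine (evalAffine R s n φ) Set.univ r := by
  obtain ⟨δ, hδ, h⟩ := lebesgue_number_lemma_of_metric (c := fun i => s ⁻¹' U i)
    (isCompact_univ (X := stdSimplex ℝ (Fin (m + 1))))
    (fun i => (hU i).preimage s.continuous)
    (fun x _ => Set.mem_iUnion.2 (hcover (s x)))
  -- Half, because the Lebesgue ball is open while fineness is a weak inequality.
  refine ⟨δ / 2, half_pos hδ, fun w _ hw => ?_⟩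
  obtain ⟨i, hi⟩ := h (w 0) (Set.mem_univ _)
  refine hφ _ ⟨i, fun t => hi ?_⟩
  exact (dist_affineSimplex_le w (w 0) (fun j => hw j 0) t).trans_lt (half_lt_self hδ)

/-- All distances in a standard simplex are at most 1, so vanishing at scale 1 means vanishing
identically. -/
theorem exists_subdivision_pow_vanishes (hU : ∀ i, IsOpen (U i)) (hcover : ∀ x, ∃ i, x ∈ U i)
    {m n : ℕ} (s : SingularSimplex X m) {φ : SingularCochain R X n}
    (hφ : ∀ s, IsSmallSimplex U s → φ s = 0) :
    ∃ K, ∀ k ≥ K, VanishesOnFine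
      ((subdivision R (simplexBarycenter m) n ^ k) (evalAffine R s n φ)) Set.univ 1 := by
  obtain ⟨r, hr, h⟩ := exists_vanishesOnFine hU hcover s hφ
  have hlt : (n / (n + 1) : ℝ) < 1 := by
    rw [div_lt_one (by positivity)]
    linarith
  obtain ⟨K, hK⟩ := exists_pow_lt_of_lt_one hr hlt
  refine ⟨K, fun k hk => VanishesOnFine.subdivision_pow isBarycentric_simplexBarycenter
    (fun _ _ _ => Set.mem_univ _) k fun w hw hwr => h w hw fun i j => (hwr i j).trans ?_⟩
  rw [mul_one]
  exact (pow_le_pow_of_le_one (by positivity) hlt.le hk).trans hK.le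

/-- **Small simplices.** A cocycle vanishing on the simplices that are small for an open cover is
the coboundary of a cochain vanishing on small simplices. -/
theorem exists_primitive_of_vanishes_on_small (hU : ∀ i, IsOpen (U i))
    (hcover : ∀ x, ∃ i, x ∈ U i) {n : ℕ} (φ : SingularCochain R X (n + 1))
    (hφ : ∀ s, IsSmallSimplex U s → φ s = 0) (hcocycle : singularCoboundary R X (n + 1) φ = 0) :
    ∃ ψ : SingularCochain R X n, (∀ s, IsSmallSimplex U s → ψ s = 0) ∧
      singularCoboundary R X n ψ = φ := by
  choose K hK using fun s : SingularSimplex X n =>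
    exists_subdivision_pow_vanishes hU hcover s hφ
  have hstable : ∀ m, IsBarycenterStable (simplexBarycenter m) Set.univ :=
    fun _ _ _ _ => Set.mem_univ _
  -- The number of subdivisions needed depends on the simplex. For k ≥ `K s` the further summands of
  -- the homotopy vanish, so D k s is constant; this stable value defines the primitive.
  let D (k : ℕ) (s : SingularSimplex X n) : R :=
    iteratedHomotopy R (simplexBarycenter n) k n (evalAffine R s (n + 1) φ) stdSimplex.vertex
  have hD : ∀ k s, K s ≤ k → D k s = D (K s) s := by
    intro k s hk
    induction k, hk using Nat.le_induction with
    | base => rfl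
    | succ k hk ih =>
      rw [← ih]
      simp only [D, iteratedHomotopy_apply]
      rw [Finset.sum_range_succ, Pi.add_apply, (hK s k hk).subdivisionHomotopy
        isBarycentric_simplexBarycenter (hstable n) _ (fun _ => Set.mem_univ _)
        (fun i j => dist_stdSimplex_le_one _ _), add_zero]
  refine ⟨fun s => D (K s) s, fun s hs => ?_, ?_⟩
  · simp only [D, iteratedHomotopy_apply, Finset.sum_apply]
    refine Finset.sum_eq_zero fun j _ => ?_
    exact VanishesOnFine.subdivisionHomotopy isBarycentric_simplexBarycenter (hstable n)
      (VanishesOnFine.subdivision_pow isBarycentric_simplexBarycenter (hstable n) j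
        (hs.vanishesOnFine hφ _)) _ (fun _ => Set.mem_univ _)
        (fun i j => dist_stdSimplex_le_one _ _)
  · ext s
    obtain ⟨K', hK'⟩ := exists_subdivision_pow_vanishes hU hcover s hφ
    -- Large enough for s and all its faces at once. The values on the faces then come from one
    -- homotopy on the simplex of s, and the remainder Sdᵏφ vanishes there.
    let k := K' + ∑ i, K (s.comp (faceInclusion n i))
    have hface : ∀ i, D (K (s.comp (faceInclusion n i))) (s.comp (faceInclusion n i)) =
        iteratedHomotopy R (simplexBarycenter (n + 1)) k n (evalAffine R s (n + 1) φ)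
          (stdSimplex.vertex ∘ i.succAbove) := by
      intro i
      rw [← hD k _ ((Finset.single_le_sum (f := fun i => K (s.comp (faceInclusion n i)))
        (fun _ _ => Nat.zero_le _) (Finset.mem_univ i)).trans (Nat.le_add_left _ _))]
      simp only [D]
      rw [evalAffine_comp_faceInclusion, iteratedHomotopy_orderedPullback _ _
        (simplexBarycenter (n + 1)) fun _ v => faceInclusion_simplexBarycenter i v,
        orderedPullback_apply]
      exact congrArg _ (funext fun j => stdSimplex.map_vertex _ _)
    have hcob := congrFun (orderedCoboundary_iteratedHomotopy (simplexBarycenter (n + 1)) k n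
      (evalAffine R s (n + 1) φ) (by rw [orderedCoboundary_evalAffine, hcocycle, map_zero]))
      stdSimplex.vertex
    rw [Pi.sub_apply, hK' k (Nat.le_add_right _ _) _ (fun _ => Set.mem_univ _)
      (fun i j => dist_stdSimplex_le_one _ _), sub_zero, evalAffine_vertex,
      orderedCoboundary_apply] at hcob
    rw [← hcob]
    simp only [singularCoboundary, LinearMap.coe_mk, AddHom.coe_mk, hface]

end Small

end

noncomputable section

universe u w

/-! ### The edges of a nerve -/

section Edge

variable {R : Type*} [CommRing R] {ι : Type*} [LinearOrder ι] {K : PreAbstractSimplicialComplex ι}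

theorem NSimplex.exists_lt (τ : NSimplex K 1) : ∃ a b : τ.1.1, a.1 < b.1 := by
  obtain ⟨x, y, hxy, h⟩ := Finset.card_eq_two.1 τ.2
  have hx : x ∈ τ.1.1 := by simp [h]
  have hy : y ∈ τ.1.1 := by simp [h]
  rcases lt_or_gt_of_ne hxy with hlt | hlt
  · exact ⟨⟨x, hx⟩, ⟨y, hy⟩, hlt⟩
  · exact ⟨⟨y, hy⟩, ⟨x, hx⟩, hlt⟩

theorem NSimplex.eq_or_eq (τ : NSimplex K 1) {a b : τ.1.1} (hab : a.1 < b.1) {x : ι}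
    (hx : x ∈ τ.1.1) : x = a.1 ∨ x = b.1 := by
  have h : ({a.1, b.1} : Finset ι) = τ.1.1 := by
    refine Finset.eq_of_subset_of_card_le (Finset.insert_subset a.2 ?_) ?_
    · exact Finset.singleton_subset_iff.2 b.2
    · rw [τ.2, Finset.card_pair hab.ne]
  simpa using (h.ge hx : x ∈ ({a.1, b.1} : Finset ι))

theorem sheafCoboundary_edge (F : CellularSheaf R K) (φ : SheafCochain F 0) (τ : NSimplex K 1)
    {a b : τ.1.1} (hab : a.1 < b.1) :
    sheafCoboundary F 0 φ τ =
      F.map (τ.facet_subset a) (φ (τ.facet a)) - F.map (τ.facet_subset b) (φ (τ.facet b)) := by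
  have ha : incidence τ.1.1 a.1 = 1 := by
    rw [incidence, Finset.card_eq_zero.2, pow_zero]
    rw [Finset.filter_eq_empty_iff]
    intro x hx
    rcases τ.eq_or_eq hab hx with rfl | rfl
    · exact lt_irrefl _
    · exact hab.not_gt
  have hb : incidence τ.1.1 b.1 = -1 := by
    have h : τ.1.1.filter (· < b.1) = {a.1} := by
      ext x
      rw [Finset.mem_filter, Finset.mem_singleton]
      constructor
      · rintro ⟨hx, hlt⟩
        exact (τ.eq_or_eq hab hx).resolve_right hlt.ne
      · rintro rfl
        exact ⟨a.2, hab⟩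
    rw [incidence, h, Finset.card_singleton, pow_one]
  change ∑ v : τ.1.1, incidence τ.1.1 v.1 • F.map (τ.facet_subset v) (φ (τ.facet v)) = _
  rw [Fintype.sum_eq_add a b (fun h => hab.ne (congrArg Subtype.val h)), ha, hb, one_smul,
    neg_one_smul, sub_eq_add_neg]
  rintro ⟨x, hx⟩ ⟨hxa, hxb⟩
  rcases τ.eq_or_eq hab hx with h | h
  · exact absurd (Subtype.ext h) hxa
  · exact absurd (Subtype.ext h) hxb

end Edge

/-! ### The double complex of a cover -/

section DoubleComplex

variable (R : Type w) [CommRing R] {X : Type u} [TopologicalSpace X] {Y : Type*} (f : X → Y)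
  {ι : Type*} (V : ι → Set Y)

/-- The cellular sheaf of singular cochains `σ ↦ Cⁿ(f⁻¹(V_σ); R)`. -/
abbrev cochainSheaf (n : ℕ) : CellularSheaf.{max u w} R (nerveComplex V) where
  obj σ := SingularCochain R (f ⁻¹' nerveSupport V σ.1) n
  map h := singularPullback R
    (ContinuousMap.inclusion (Set.preimage_mono (nerveSupport_anti V h))) n
  map_id _ _ := rfl
  map_comp _ _ _ := rfl

/-- The simplexwise singular coboundary. -/
def familyCoboundary (k n : ℕ) :
    SheafCochain (cochainSheaf R f V n) k →ₗ[R] SheafCochain (cochainSheaf R f V (n + 1)) k :=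
  LinearMap.pi fun σ => singularCoboundary R (f ⁻¹' nerveSupport V σ.1.1) n ∘ₗ LinearMap.proj σ

/-- The inclusion of a subset, as a continuous map. -/
def subsetInclusion (U : Set X) : C(U, X) :=
  ⟨Subtype.val, continuous_subtype_val⟩

/-- Restriction of singular cochains of `X` to the sets of the cover. -/
def restrictVertices (n : ℕ) :
    SingularCochain R X n →ₗ[R] SheafCochain (cochainSheaf R f V n) 0 :=
  LinearMap.pi fun σ => singularPullback R (subsetInclusion (f ⁻¹' nerveSupport V σ.1.1)) n

variable {R f V}

theorem familyCoboundary_comp (k n : ℕ) (c : SheafCochain (cochainSheaf R f V n) k) :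
    familyCoboundary R f V k (n + 1) (familyCoboundary R f V k n c) = 0 := by
  funext σ
  exact singularCoboundary_comp R _ n (c σ)

theorem familyCoboundary_restrictVertices (n : ℕ) (a : SingularCochain R X n) :
    familyCoboundary R f V 0 n (restrictVertices R f V n a) =
      restrictVertices R f V (n + 1) (singularCoboundary R X n a) :=
  rfl

/-- The restriction of the codomain of a singular simplex. -/
def liftSimplex {U : Set X} {n : ℕ} (s : SingularSimplex X n) (h : ∀ t, s t ∈ U) :
    SingularSimplex U n :=
  ⟨fun t => ⟨s t, h t⟩, s.continuous.subtype_mk h⟩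

variable (V) in
/-- The vertices of the nerve index the cover by the sets `f⁻¹(V_i)`. -/
abbrev vertexCover (f : X → Y) (σ : NSimplex (nerveComplex V) 0) : Set X :=
  f ⁻¹' nerveSupport V σ.1.1

theorem restrictVertices_eq_zero_iff (n : ℕ) (a : SingularCochain R X n) :
    restrictVertices R f V n a = 0 ↔ ∀ s, IsSmallSimplex (vertexCover V f) s → a s = 0 := by
  constructor
  · rintro h s ⟨σ, hσ⟩
    exact congrFun (congrFun h σ) (liftSimplex s hσ)
  · intro h
    funext σ s
    exact h _ ⟨σ, fun t => (s t).2⟩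

/-! ### Exactness of the Mayer–Vietoris sequence of cochains -/

section Sheaf

variable [LinearOrder ι]

theorem sheafCoboundary_familyCoboundary (k n : ℕ) (c : SheafCochain (cochainSheaf R f V n) k) :
    sheafCoboundary (cochainSheaf R f V (n + 1)) k (familyCoboundary R f V k n c) =
      familyCoboundary R f V (k + 1) n (sheafCoboundary (cochainSheaf R f V n) k c) := by
  funext τ
  change _ = singularCoboundary R _ n (∑ v : τ.1.1, _)
  rw [map_sum]
  refine Finset.sum_congr rfl fun v _ => ?_
  rw [map_zsmul]
  rfl

theorem sheafCoboundary_restrictVertices (n : ℕ) (a : SingularCochain R X n) :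
    sheafCoboundary (cochainSheaf R f V n) 0 (restrictVertices R f V n a) = 0 := by
  funext τ
  obtain ⟨x, y, hxy⟩ := τ.exists_lt
  rw [sheafCoboundary_edge _ _ τ hxy]
  exact sub_self _

/-- The members of a compatible family agree on every simplex lying in two sets of the cover. -/
theorem restriction_eq_of_sheafCoboundary_eq_zero {n : ℕ}
    {c : SheafCochain (cochainSheaf R f V n) 0}
    (hc : sheafCoboundary (cochainSheaf R f V n) 0 c = 0)
    (σ σ' : NSimplex (nerveComplex V) 0) (s : SingularSimplex X n)
    (h : ∀ t, s t ∈ vertexCover V f σ) (h' : ∀ t, s t ∈ vertexCover V f σ') :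
    c σ (liftSimplex s h) = c σ' (liftSimplex s h') := by
  obtain ⟨x, hx⟩ := Finset.card_eq_one.1 σ.2
  obtain ⟨y, hy⟩ := Finset.card_eq_one.1 σ'.2
  have hcongr : ∀ (ρ ρ' : NSimplex (nerveComplex V) 0) (_ : ρ = ρ')
      (h : ∀ t, s t ∈ vertexCover V f ρ) (h' : ∀ t, s t ∈ vertexCover V f ρ'),
      c ρ (liftSimplex s h) = c ρ' (liftSimplex s h') := by
    rintro ρ _ rfl h h'
    rfl
  wlog hxy : x < y generalizing σ σ' x y
  · rcases (not_lt.1 hxy).eq_or_lt with rfl | hlt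
    · exact hcongr _ _ (Subtype.ext (Subtype.ext (hx.trans hy.symm))) _ _
    · exact (this σ' σ h' h y hy x hx hlt).symm
  have hmem : ∀ t, f (s t) ∈ nerveSupport V {x, y} := by
    intro t
    have h1 := h t
    have h2 := h' t
    simp only [vertexCover, Set.mem_preimage, nerveSupport, hx, hy, Set.mem_iInter,
      Finset.mem_singleton, Finset.mem_insert, forall_eq, forall_eq_or_imp] at h1 h2 ⊢
    exact ⟨h1, h2⟩
  -- {x, y} is an edge because the image of any point of s, here its barycenter, lies in both sets.
  let τ : NSimplex (nerveComplex V) 1 :=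
    ⟨⟨{x, y}, ⟨Finset.insert_nonempty _ _, ⟨_, hmem stdSimplex.barycenter⟩⟩⟩,
      Finset.card_pair hxy.ne⟩
  let a : τ.1.1 := ⟨x, Finset.mem_insert_self _ _⟩
  let b : τ.1.1 := ⟨y, Finset.mem_insert_of_mem (Finset.mem_singleton_self _)⟩
  have ha : τ.facet a = σ' := by
    refine Subtype.ext (Subtype.ext ?_)
    rw [hy]
    change ({x, y} : Finset ι).erase x = {y}
    grind
  have hb : τ.facet b = σ := by
    refine Subtype.ext (Subtype.ext ?_)
    rw [hx]
    change ({x, y} : Finset ι).erase y = {x}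
    grind
  have key := congrFun (congrFun hc τ) (liftSimplex s hmem)
  rw [sheafCoboundary_edge _ _ τ (a := a) (b := b) hxy] at key
  have key' := sub_eq_zero.1 key
  rw [hcongr σ' (τ.facet a) ha.symm h'
    (fun t => nerveSupport_anti V (τ.facet_subset a) (hmem t)),
    hcongr σ (τ.facet b) hb.symm h (fun t => nerveSupport_anti V (τ.facet_subset b) (hmem t))]
  exact key'.symm

theorem exists_restrictVertices_eq {n : ℕ} {c : SheafCochain (cochainSheaf R f V n) 0}
    (hc : sheafCoboundary (cochainSheaf R f V n) 0 c = 0) :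
    ∃ a, restrictVertices R f V n a = c := by
  classical
  refine ⟨fun s => if h : IsSmallSimplex (vertexCover V f) s then
    c h.choose (liftSimplex s h.choose_spec) else 0, ?_⟩
  funext σ s
  have hs : IsSmallSimplex (vertexCover V f) ((subsetInclusion _).comp s) :=
    ⟨σ, fun t => (s t).2⟩
  exact (dif_pos hs).trans (restriction_eq_of_sheafCoboundary_eq_zero hc _ σ _ hs.choose_spec
    fun t => (s t).2)

/-- The union of the two edges is itself a simplex, hence has at most two vertices. -/
theorem NSimplex.eq_of_mem_nerveSupport (hdim : ∀ σ ∈ nerveComplex V, σ.card ≤ 2)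
    (τ τ' : NSimplex (nerveComplex V) 1) {y : Y} (h : y ∈ nerveSupport V τ.1.1)
    (h' : y ∈ nerveSupport V τ'.1.1) : τ = τ' := by
  have hmem : τ.1.1 ∪ τ'.1.1 ∈ nerveComplex V := by
    refine ⟨τ.1.2.1.mono Finset.subset_union_left, ⟨y, ?_⟩⟩
    simp only [nerveSupport, Set.mem_iInter] at h h' ⊢
    intro i hi
    exact (Finset.mem_union.1 hi).elim (h i) (h' i)
  have hcard := hdim _ hmem
  refine Subtype.ext (Subtype.ext ?_)
  rw [Finset.eq_of_subset_of_card_le Finset.subset_union_left (hcard.trans τ.2.ge),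
    ← Finset.eq_of_subset_of_card_le Finset.subset_union_right (hcard.trans τ'.2.ge)]

theorem NSimplex.facet_injective {K : PreAbstractSimplicialComplex ι} {n : ℕ}
    (τ : NSimplex K (n + 1)) : Function.Injective τ.facet := by
  intro a b h
  have h' : τ.1.1.erase a.1 = τ.1.1.erase b.1 := congrArg (fun σ => σ.1.1) h
  exact Subtype.ext (Finset.erase_injOn _ a.2 b.2 h')

/-- A singular simplex lies over at most one edge. The prescribed value on that edge is assigned to
its larger vertex, the one entering the coboundary with sign +1, and 0 is assigned everywhere else.
-/
theorem sheafCoboundary_cochainSheaf_surjective (hdim : ∀ σ ∈ nerveComplex V, σ.card ≤ 2) (n : ℕ) :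
    Function.Surjective (sheafCoboundary (cochainSheaf R f V n) 0) := by
  classical
  intro q
  let P (σ : NSimplex (nerveComplex V) 0) (s : SingularSimplex X n)
      (τ : NSimplex (nerveComplex V) 1) : Prop :=
    (∃ a b : τ.1.1, a.1 < b.1 ∧ τ.facet a = σ) ∧ ∀ t, s t ∈ f ⁻¹' nerveSupport V τ.1.1
  let g (σ : NSimplex (nerveComplex V) 0) (s : SingularSimplex X n) : R :=
    if h : ∃ τ, P σ s τ then q h.choose (liftSimplex s h.choose_spec.2) else 0
  have hcongr : ∀ (s : SingularSimplex X n) (τ τ' : NSimplex (nerveComplex V) 1) (_ : τ = τ')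
      (h : ∀ t, s t ∈ f ⁻¹' nerveSupport V τ.1.1) (h' : ∀ t, s t ∈ f ⁻¹' nerveSupport V τ'.1.1),
      q τ (liftSimplex s h) = q τ' (liftSimplex s h') := by
    rintro s τ _ rfl h h'
    rfl
  refine ⟨fun σ s => g σ ((subsetInclusion _).comp s), ?_⟩
  funext τ s
  obtain ⟨a, b, hab⟩ := τ.exists_lt
  rw [sheafCoboundary_edge _ _ τ hab]
  let s' : SingularSimplex X n := (subsetInclusion _).comp s
  have hs' : ∀ t, s' t ∈ f ⁻¹' nerveSupport V τ.1.1 := fun t => (s t).2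
  have huniq : ∀ τ', (∀ t, s' t ∈ f ⁻¹' nerveSupport V τ'.1.1) → τ' = τ := fun τ' h =>
    NSimplex.eq_of_mem_nerveSupport hdim τ' τ (h stdSimplex.barycenter)
      (hs' stdSimplex.barycenter)
  have ha : g (τ.facet a) s' = q τ s := by
    have h : ∃ τ', P (τ.facet a) s' τ' := ⟨τ, ⟨a, b, hab, rfl⟩, hs'⟩
    exact (dif_pos h).trans (hcongr s' _ τ (huniq _ h.choose_spec.2) _ hs')
  have hb : g (τ.facet b) s' = 0 := by
    refine dif_neg ?_
    rintro ⟨τ', ⟨a', b', hab', hfacet⟩, h⟩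
    obtain rfl := huniq τ' h
    obtain rfl := τ'.facet_injective hfacet
    rcases τ'.eq_or_eq hab b'.2 with hb' | hb'
    · exact (hab.trans hab').ne hb'.symm
    · exact hab'.ne hb'.symm
  change g (τ.facet a) s' - g (τ.facet b) s' = q τ s
  rw [ha, hb, sub_zero]

end Sheaf

/-! ### Consequences of the small simplices theorem -/

section Acyclic

theorem eq_zero_of_restrictVertices_eq_zero
    (hcover : ∀ x, ∃ σ, x ∈ vertexCover V f σ)
    {a : SingularCochain R X 0}
    (ha : restrictVertices R f V 0 a = 0) : a = 0 := by
  rw [restrictVertices_eq_zero_iff] at ha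
  funext s
  obtain ⟨σ, hσ⟩ := hcover (s default)
  -- The standard 0-simplex is a point, so every 0-simplex is small.
  exact ha s ⟨σ, fun t => by rwa [Subsingleton.elim t default]⟩

theorem exists_primitive_of_restrictVertices_eq_zero
    (hopen : ∀ σ, IsOpen (vertexCover V f σ))
    (hcover : ∀ x, ∃ σ, x ∈ vertexCover V f σ)
    {n : ℕ} {a : SingularCochain R X (n + 1)}
    (ha : restrictVertices R f V (n + 1) a = 0) (hd : singularCoboundary R X (n + 1) a = 0) :
    ∃ k, restrictVertices R f V n k = 0 ∧ singularCoboundary R X n k = a := by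
  rw [restrictVertices_eq_zero_iff] at ha
  obtain ⟨k, hk, hka⟩ := exists_primitive_of_vanishes_on_small hopen hcover a ha hd
  exact ⟨k, (restrictVertices_eq_zero_iff n k).2 hk, hka⟩

/-- A glued cochain a need not be a cocycle, but δa vanishes on small simplices. It is therefore δk
for some k vanishing on them, and a - k is the required cocycle. -/
theorem exists_cocycle_restrictVertices_eq
    (hopen : ∀ σ, IsOpen (vertexCover V f σ))
    (hcover : ∀ x, ∃ σ, x ∈ vertexCover V f σ)
    [LinearOrder ι] {n : ℕ}
    {c : SheafCochain (cochainSheaf R f V n) 0}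
    (hc : sheafCoboundary (cochainSheaf R f V n) 0 c = 0)
    (hd : familyCoboundary R f V 0 n c = 0) :
    ∃ a, restrictVertices R f V n a = c ∧ singularCoboundary R X n a = 0 := by
  obtain ⟨a, rfl⟩ := exists_restrictVertices_eq hc
  rw [familyCoboundary_restrictVertices] at hd
  obtain ⟨k, hk, hka⟩ := exists_primitive_of_restrictVertices_eq_zero hopen hcover hd
    (singularCoboundary_comp R X n a)
  exact ⟨a - k, by rw [map_sub, hk, sub_zero], by rw [map_sub, hka, sub_self]⟩

end Acyclic

end DoubleComplex

end

noncomputable section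

universe u w

/-! ### Linear algebra -/

section LinearAlgebra

variable {R : Type*} [CommRing R] {W M N : Type*} [AddCommGroup W] [Module R W]
  [AddCommGroup M] [Module R M] [AddCommGroup N] [Module R N]

/-- Two surjections with the same kernel have isomorphic targets. -/
theorem nonempty_linearEquiv_of_ker_eq (p : W →ₗ[R] M) (q : W →ₗ[R] N)
    (hp : Function.Surjective p) (hq : Function.Surjective q)
    (h : LinearMap.ker p = LinearMap.ker q) : Nonempty (M ≃ₗ[R] N) :=
  ⟨(p.quotKerEquivOfSurjective hp).symm ≪≫ₗ Submodule.quotEquivOfEq _ _ h ≪≫ₗ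
    q.quotKerEquivOfSurjective hq⟩

/-- A vector space is isomorphic to the product of the range and the kernel of a linear map. -/
theorem nonempty_linearEquiv_range_prod_ker {R : Type*} [DivisionRing R] {M N : Type*}
    [AddCommGroup M] [Module R M] [AddCommGroup N] [Module R N] (p : M →ₗ[R] N) :
    Nonempty (M ≃ₗ[R] LinearMap.range p × LinearMap.ker p) := by
  obtain ⟨C, hC⟩ := (LinearMap.ker p).exists_isCompl
  exact ⟨(Submodule.prodEquivOfIsCompl _ _ hC).symm ≪≫ₗ LinearEquiv.prodComm R _ _ ≪≫ₗ
    LinearEquiv.prodCongr ((Submodule.quotientEquivOfIsCompl _ _ hC).symm ≪≫ₗ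
      p.quotKerEquivRange) (LinearEquiv.refl R _)⟩

end LinearAlgebra

/-! ### The Leray sheaf of a cover with one-dimensional nerve -/

section Leray

variable (R : Type w) [CommRing R] {X : Type u} [TopologicalSpace X] {Y : Type*} (f : X → Y)
  {ι : Type*} (V : ι → Set Y)

/-- The class of a cocycle in the Leray sheaf. -/
def lerayClass (n : ℕ) (σ : nerveComplex V) :
    LinearMap.ker (singularCoboundary R (f ⁻¹' nerveSupport V σ.1) n) →ₗ[R]
      (leraySheaf R f V n).obj σ :=
  Submodule.mkQ ((coboundaries (singularCoboundary R (f ⁻¹' nerveSupport V σ.1)) n).submoduleOf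
    (LinearMap.ker (singularCoboundary R (f ⁻¹' nerveSupport V σ.1) n)))

/-- The class in the Leray sheaf of a family of cocycles. -/
def familyClass (k n : ℕ) :
    LinearMap.ker (familyCoboundary R f V k n) →ₗ[R] SheafCochain (leraySheaf R f V n) k :=
  LinearMap.pi fun σ => lerayClass R f V n σ.1 ∘ₗ
    (LinearMap.proj σ : SheafCochain (cochainSheaf R f V n) k →ₗ[R] _).restrict
      fun _ hz => congrFun hz σ

/-- The restriction `Hⁿ(X) → ∏ Hⁿ(f⁻¹(V_i))`. -/
def cohomologyRestriction (n : ℕ) :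
    SingularCohomology R X n →ₗ[R] SheafCochain (leraySheaf R f V n) 0 :=
  LinearMap.pi fun σ => SingularCohomology.map R (subsetInclusion (f ⁻¹' nerveSupport V σ.1.1)) n

variable {R f V}

theorem lerayClass_surjective (n : ℕ) (σ : nerveComplex V) :
    Function.Surjective (lerayClass R f V n σ) :=
  Submodule.mkQ_surjective _

theorem familyClass_surjective (k n : ℕ) : Function.Surjective (familyClass R f V k n) := by
  intro y
  choose z hz using fun σ : NSimplex (nerveComplex V) k => lerayClass_surjective n σ.1 (y σ)
  exact ⟨⟨fun σ => (z σ).1, funext fun σ => (z σ).2⟩, funext hz⟩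

theorem familyClass_eq_zero_iff {k n : ℕ} (z : LinearMap.ker (familyCoboundary R f V k n)) :
    familyClass R f V k n z = 0 ↔
      ∀ σ, z.1 σ ∈ coboundaries (singularCoboundary R (f ⁻¹' nerveSupport V σ.1.1)) n := by
  rw [funext_iff]
  exact forall_congr' fun σ => Submodule.Quotient.mk_eq_zero _

theorem familyClass_zero_eq_zero_iff {k : ℕ} (z : LinearMap.ker (familyCoboundary R f V k 0)) :
    familyClass R f V k 0 z = 0 ↔ z.1 = 0 := by
  rw [familyClass_eq_zero_iff, funext_iff]
  rfl

theorem familyClass_succ_eq_zero_iff {k n : ℕ}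
    (z : LinearMap.ker (familyCoboundary R f V k (n + 1))) :
    familyClass R f V k (n + 1) z = 0 ↔ ∃ c, familyCoboundary R f V k n c = z.1 := by
  rw [familyClass_eq_zero_iff]
  constructor
  · intro h
    choose c hc using h
    exact ⟨c, funext hc⟩
  · rintro ⟨c, hc⟩ σ
    exact ⟨c σ, congrFun hc σ⟩

theorem restrictVertices_mem_ker {n : ℕ} (a : LinearMap.ker (singularCoboundary R X n)) :
    restrictVertices R f V n a.1 ∈ LinearMap.ker (familyCoboundary R f V 0 n) := by
  rw [LinearMap.mem_ker, familyCoboundary_restrictVertices, a.2, map_zero]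

theorem cohomologyRestriction_mk {n : ℕ} (a : LinearMap.ker (singularCoboundary R X n)) :
    cohomologyRestriction R f V n (Submodule.Quotient.mk a) =
      familyClass R f V 0 n ⟨restrictVertices R f V n a.1, restrictVertices_mem_ker a⟩ :=
  rfl

variable (R f V) in
/-- Pairs of a cocycle `a` of `X` and a family of primitives of its restrictions. -/
def primitivePairs (n : ℕ) : Submodule R
    (LinearMap.ker (singularCoboundary R X (n + 1)) × SheafCochain (cochainSheaf R f V n) 0) :=
  LinearMap.eqLocus
    (restrictVertices R f V (n + 1) ∘ₗ Submodule.subtype _ ∘ₗ LinearMap.fst R _ _)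
    (familyCoboundary R f V 0 n ∘ₗ LinearMap.snd R _ _)

theorem primitivePairs_spec {n : ℕ} (x : primitivePairs R f V n) :
    restrictVertices R f V (n + 1) x.1.1.1 = familyCoboundary R f V 0 n x.1.2 :=
  x.2

variable (R f V) in
/-- The class of a cocycle whose restrictions are coboundaries. -/
def primitivePairsToKer (n : ℕ) :
    primitivePairs R f V n →ₗ[R] LinearMap.ker (cohomologyRestriction R f V (n + 1)) :=
  ((Submodule.mkQ _ ∘ₗ LinearMap.fst R _ _) ∘ₗ (primitivePairs R f V n).subtype).codRestrict _
    fun x => (familyClass_succ_eq_zero_iff ⟨_, restrictVertices_mem_ker x.1.1⟩).2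
      ⟨x.1.2, (primitivePairs_spec x).symm⟩

theorem primitivePairsToKer_surjective (n : ℕ) :
    Function.Surjective (primitivePairsToKer R f V n) := by
  rintro ⟨a, ha⟩
  obtain ⟨a, rfl⟩ := Submodule.Quotient.mk_surjective _ a
  have ha' := ha
  rw [LinearMap.mem_ker, cohomologyRestriction_mk, familyClass_succ_eq_zero_iff] at ha'
  obtain ⟨c, hc⟩ := ha'
  exact ⟨⟨(a, c), hc.symm⟩, rfl⟩

theorem ker_cohomologyRestriction_zero (hcover : ∀ x, ∃ σ, x ∈ vertexCover V f σ) :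
    LinearMap.ker (cohomologyRestriction R f V 0) = ⊥ := by
  rw [LinearMap.ker_eq_bot']
  intro a ha
  obtain ⟨a, rfl⟩ := Submodule.Quotient.mk_surjective _ a
  rw [cohomologyRestriction_mk, familyClass_zero_eq_zero_iff] at ha
  have h : a = 0 := Subtype.ext (eq_zero_of_restrictVertices_eq_zero hcover ha)
  rw [h]
  rfl

variable [LinearOrder ι]

theorem sheafCoboundary_mem_ker {k n : ℕ} (z : LinearMap.ker (familyCoboundary R f V k n)) :
    sheafCoboundary (cochainSheaf R f V n) k z.1 ∈
      LinearMap.ker (familyCoboundary R f V (k + 1) n) := by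
  rw [LinearMap.mem_ker, ← sheafCoboundary_familyCoboundary, z.2, map_zero]

/-- Passing to classes commutes with the restriction maps and with signed sums, so the Leray
coboundary can be computed on representatives. -/
theorem sheafCoboundary_familyClass {k n : ℕ} (z : LinearMap.ker (familyCoboundary R f V k n)) :
    sheafCoboundary (leraySheaf R f V n) k (familyClass R f V k n z) =
      familyClass R f V (k + 1) n
        ⟨sheafCoboundary (cochainSheaf R f V n) k z.1, sheafCoboundary_mem_ker z⟩ := by
  funext τ
  let Z := LinearMap.ker (singularCoboundary R (f ⁻¹' nerveSupport V τ.1.1) n)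
  let B := (coboundaries (singularCoboundary R (f ⁻¹' nerveSupport V τ.1.1)) n).submoduleOf Z
  let y (v : τ.1.1) : Z := cocyclesMap
    (singularCoboundary R (f ⁻¹' nerveSupport V (τ.facet v).1.1))
    (singularCoboundary R (f ⁻¹' nerveSupport V τ.1.1))
    (singularPullback R (ContinuousMap.inclusion
      (Set.preimage_mono (nerveSupport_anti V (τ.facet_subset v))))) (fun _ _ => rfl) n
    ⟨z.1 (τ.facet v), congrFun z.2 (τ.facet v)⟩
  have h : B.mkQ (∑ v : τ.1.1, incidence τ.1.1 v.1 • y v) =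
      ∑ v : τ.1.1, incidence τ.1.1 v.1 • B.mkQ (y v) := by
    rw [map_sum]
    exact Finset.sum_congr rfl fun v _ => map_zsmul _ _ _
  refine h.symm.trans (congrArg B.mkQ (Subtype.ext ?_))
  rw [AddSubmonoidClass.coe_finsetSum]
  rfl

/-! ### The range and the kernel of restriction in cohomology -/

section Cover

/-- A family of cocycles whose class is a section is cohomologous to a compatible family. -/
theorem exists_compatible_family
    (hdim : ∀ σ ∈ nerveComplex V, σ.card ≤ 2)
    {n : ℕ} (z : LinearMap.ker (familyCoboundary R f V 0 n))
    (hz : sheafCoboundary (leraySheaf R f V n) 0 (familyClass R f V 0 n z) = 0) :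
    ∃ z' : LinearMap.ker (familyCoboundary R f V 0 n),
      familyClass R f V 0 n z' = familyClass R f V 0 n z ∧
        sheafCoboundary (cochainSheaf R f V n) 0 z'.1 = 0 := by
  rw [sheafCoboundary_familyClass] at hz
  cases n with
  | zero => exact ⟨z, rfl, (familyClass_zero_eq_zero_iff _).1 hz⟩
  | succ n =>
    obtain ⟨q, hq⟩ := (familyClass_succ_eq_zero_iff _).1 hz
    -- On the edges δz = dq with q = δc, so z - dc has the same class and δ(z - dc) = 0.
    obtain ⟨c, rfl⟩ := sheafCoboundary_cochainSheaf_surjective hdim n q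
    have hmem : familyCoboundary R f V 0 n c ∈
        LinearMap.ker (familyCoboundary R f V 0 (n + 1)) := familyCoboundary_comp 0 n c
    refine ⟨z - ⟨_, hmem⟩, ?_, ?_⟩
    · rw [map_sub, (familyClass_succ_eq_zero_iff ⟨_, hmem⟩).2 ⟨c, rfl⟩, sub_zero]
    · rw [Submodule.coe_sub, map_sub, sheafCoboundary_familyCoboundary, hq]
      exact sub_self _

theorem range_cohomologyRestriction
    (hdim : ∀ σ ∈ nerveComplex V, σ.card ≤ 2)
    (hopen : ∀ σ, IsOpen (vertexCover V f σ))
    (hcover : ∀ x, ∃ σ, x ∈ vertexCover V f σ)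
    (n : ℕ) :
    LinearMap.range (cohomologyRestriction R f V n) =
      LinearMap.ker (sheafCoboundary (leraySheaf R f V n) 0) := by
  apply le_antisymm
  · rintro _ ⟨a, rfl⟩
    obtain ⟨a, rfl⟩ := Submodule.Quotient.mk_surjective _ a
    rw [LinearMap.mem_ker, cohomologyRestriction_mk, sheafCoboundary_familyClass]
    convert map_zero (familyClass R f V 1 n)
    exact sheafCoboundary_restrictVertices n a.1
  · intro y hy
    obtain ⟨z, rfl⟩ := familyClass_surjective 0 n y
    obtain ⟨z', hz', hc⟩ := exists_compatible_family hdim z hy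
    obtain ⟨a, ha, hd⟩ := exists_cocycle_restrictVertices_eq hopen hcover hc z'.2
    refine ⟨Submodule.Quotient.mk ⟨a, hd⟩, ?_⟩
    rw [cohomologyRestriction_mk, ← hz']
    exact congrArg _ (Subtype.ext ha)

theorem sheafCoboundary_primitive_mem_ker {n : ℕ} (x : primitivePairs R f V n) :
    sheafCoboundary (cochainSheaf R f V n) 0 x.1.2 ∈ LinearMap.ker (familyCoboundary R f V 1 n) := by
  rw [LinearMap.mem_ker, ← sheafCoboundary_familyCoboundary, ← primitivePairs_spec,
    sheafCoboundary_restrictVertices]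

theorem ker_sheafCoboundary_one_eq_top
    (hdim : ∀ σ ∈ nerveComplex V, σ.card ≤ 2)
    (F : CellularSheaf R (nerveComplex V)) :
    LinearMap.ker (sheafCoboundary F 1) = ⊤ := by
  refine LinearMap.ker_eq_top.2 (LinearMap.ext fun φ => funext fun τ => ?_)
  have h1 := hdim _ τ.1.2
  have h2 := τ.2
  omega

/-- The difference of primitives on the edges of the nerve. -/
def primitivePairsToSheaf (hdim : ∀ σ ∈ nerveComplex V, σ.card ≤ 2) (n : ℕ) :
    primitivePairs R f V n →ₗ[R] SheafCohomology (leraySheaf R f V n) 1 :=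
  Submodule.mkQ _ ∘ₗ LinearMap.codRestrict _
    (familyClass R f V 1 n ∘ₗ LinearMap.codRestrict _
      (sheafCoboundary (cochainSheaf R f V n) 0 ∘ₗ LinearMap.snd R _ _ ∘ₗ
        (primitivePairs R f V n).subtype) sheafCoboundary_primitive_mem_ker)
    fun x => by
      rw [ker_sheafCoboundary_one_eq_top hdim]
      trivial

theorem primitivePairsToSheaf_eq_zero_iff
    (hdim : ∀ σ ∈ nerveComplex V, σ.card ≤ 2) {n : ℕ} (x : primitivePairs R f V n) :
    primitivePairsToSheaf hdim n x = 0 ↔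
      ∃ z ∈ LinearMap.ker (familyCoboundary R f V 0 n),
        sheafCoboundary (cochainSheaf R f V n) 0 x.1.2 =
          sheafCoboundary (cochainSheaf R f V n) 0 z := by
  have h : primitivePairsToSheaf hdim n x = 0 ↔
      familyClass R f V 1 n ⟨_, sheafCoboundary_primitive_mem_ker x⟩ ∈
        LinearMap.range (sheafCoboundary (leraySheaf R f V n) 0) :=
    Submodule.Quotient.mk_eq_zero _
  rw [h]
  constructor
  · rintro ⟨y, hy⟩
    obtain ⟨z, rfl⟩ := familyClass_surjective 0 n y
    rw [sheafCoboundary_familyClass, eq_comm, ← sub_eq_zero, ← map_sub] at hy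
    cases n with
    | zero =>
      exact ⟨z.1, z.2, sub_eq_zero.1 ((familyClass_zero_eq_zero_iff _).1 hy)⟩
    | succ n =>
      obtain ⟨q, hq⟩ := (familyClass_succ_eq_zero_iff _).1 hy
      obtain ⟨c, rfl⟩ := sheafCoboundary_cochainSheaf_surjective hdim n q
      refine ⟨z.1 + familyCoboundary R f V 0 n c,
        Submodule.add_mem _ z.2 (familyCoboundary_comp 0 n c), ?_⟩
      rw [map_add, sheafCoboundary_familyCoboundary, hq]
      exact (add_sub_cancel _ _).symm
  · rintro ⟨z, hz, h⟩
    refine ⟨familyClass R f V 0 n ⟨z, hz⟩, ?_⟩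
    rw [sheafCoboundary_familyClass]
    exact congrArg _ (Subtype.ext h.symm)

/-- A family q of edge cocycles is δc for some c. Since δ(dc) = dq = 0, the family dc glues to a
cocycle a, and (a, c) is a pair over q. -/
theorem primitivePairsToSheaf_surjective
    (hdim : ∀ σ ∈ nerveComplex V, σ.card ≤ 2)
    (hopen : ∀ σ, IsOpen (vertexCover V f σ))
    (hcover : ∀ x, ∃ σ, x ∈ vertexCover V f σ)
    (n : ℕ) :
    Function.Surjective (primitivePairsToSheaf (R := R) (f := f) hdim n) := by
  intro y
  obtain ⟨⟨y, hy⟩, rfl⟩ := Submodule.Quotient.mk_surjective _ y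
  obtain ⟨⟨q, hq⟩, rfl⟩ := familyClass_surjective 1 n y
  obtain ⟨c, rfl⟩ := sheafCoboundary_cochainSheaf_surjective hdim n q
  rw [LinearMap.mem_ker, ← sheafCoboundary_familyCoboundary] at hq
  obtain ⟨a, ha, hd⟩ := exists_cocycle_restrictVertices_eq hopen hcover hq
    (familyCoboundary_comp 0 n c)
  exact ⟨⟨(⟨a, hd⟩, c), ha⟩, rfl⟩

/-- For a pair (a, c), both conditions say that c is the sum of a family of cocycles and the
restriction of a cochain b of X. Then a and δb have equal restrictions, hence differ by a
coboundary. -/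
theorem ker_primitivePairsToKer
    (hdim : ∀ σ ∈ nerveComplex V, σ.card ≤ 2)
    (hopen : ∀ σ, IsOpen (vertexCover V f σ))
    (hcover : ∀ x, ∃ σ, x ∈ vertexCover V f σ)
    (n : ℕ) :
    LinearMap.ker (primitivePairsToKer R f V n) =
      LinearMap.ker (primitivePairsToSheaf (R := R) (f := f) hdim n) := by
  ext x
  have h : primitivePairsToKer R f V n x = 0 ↔
      x.1.1.1 ∈ LinearMap.range (singularCoboundary R X n) :=
    Subtype.ext_iff.trans (Submodule.Quotient.mk_eq_zero _)
  rw [LinearMap.mem_ker, LinearMap.mem_ker, h, primitivePairsToSheaf_eq_zero_iff]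
  have hx := primitivePairs_spec x
  constructor
  · rintro ⟨b, hb⟩
    refine ⟨x.1.2 - restrictVertices R f V n b, ?_, ?_⟩
    · rw [LinearMap.mem_ker, map_sub, familyCoboundary_restrictVertices, hb, hx, sub_self]
    · rw [map_sub, sheafCoboundary_restrictVertices, sub_zero]
  · rintro ⟨z, hz, hzx⟩
    obtain ⟨b, hb⟩ := exists_restrictVertices_eq (R := R) (f := f) (V := V) (c := x.1.2 - z)
      (by rw [map_sub, hzx, sub_self])
    obtain ⟨k, -, hk⟩ := exists_primitive_of_restrictVertices_eq_zero hopen hcover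
      (a := x.1.1.1 - singularCoboundary R X n b)
      (by rw [map_sub, ← familyCoboundary_restrictVertices, hb, map_sub, hx,
            LinearMap.mem_ker.1 hz, sub_zero, sub_self])
      (by rw [map_sub, singularCoboundary_comp, sub_zero]; exact x.1.1.2)
    exact ⟨k + b, by rw [map_add, hk, sub_add_cancel]⟩

theorem nonempty_ker_cohomologyRestriction_equiv
    (hdim : ∀ σ ∈ nerveComplex V, σ.card ≤ 2)
    (hopen : ∀ σ, IsOpen (vertexCover V f σ))
    (hcover : ∀ x, ∃ σ, x ∈ vertexCover V f σ)
    (n : ℕ) :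
    Nonempty (LinearMap.ker (cohomologyRestriction R f V (n + 1)) ≃ₗ[R]
      SheafCohomology (leraySheaf R f V n) 1) := by
  refine nonempty_linearEquiv_of_ker_eq (W := primitivePairs R f V n)
    (primitivePairsToKer R f V n) (primitivePairsToSheaf hdim n) ?_ ?_ ?_
  · exact primitivePairsToKer_surjective n
  · exact primitivePairsToSheaf_surjective hdim hopen hcover n
  · exact ker_primitivePairsToKer hdim hopen hcover n

end Cover

end Leray

theorem isOpen_preimage_of_isOpen_trace {X Y : Type*} [TopologicalSpace X] [TopologicalSpace Y]
    {f : X → Y} (hf : Continuous f) {V : Set Y} (hV : IsOpen ((↑) ⁻¹' V : Set (Set.range f))) :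
    IsOpen (f ⁻¹' V) :=
  hV.preimage (hf.subtype_mk fun x => Set.mem_range_self x)

theorem nonempty_sheafCohomology_zero_equiv {R : Type*} [CommRing R] {ι : Type*} [LinearOrder ι]
    {K : PreAbstractSimplicialComplex ι} (F : CellularSheaf R K) :
    Nonempty (SheafCohomology F 0 ≃ₗ[R] LinearMap.ker (sheafCoboundary F 0)) :=
  ⟨Submodule.quotEquivOfEqBot _ (by
    rw [Submodule.submoduleOf, coboundaries, Submodule.comap_bot, Submodule.ker_subtype])⟩

end

/-- `H⁻¹ = 0`, so in degree `0` the second summand `H¹(N; L⁻¹)` vanishes. The sets `V i` may be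
open subsets of `f(X)`, or open subsets of `Y`: only their traces on `f(X)` have to be open. -/
theorem theorem5p5 {R : Type*} [Field R] {X Y : Type*} [TopologicalSpace X] [TopologicalSpace Y]
    (f : X → Y) (hf : Continuous f)
    {ι : Type*} [Finite ι] [LinearOrder ι] (V : ι → Set Y)
    (hopen : ∀ i, IsOpen ((↑) ⁻¹' V i : Set (Set.range f)))
    (hcover : Set.range f ⊆ ⋃ i, V i)
    (hdim : ∀ σ ∈ nerveComplex V, σ.card ≤ 2) :
    Nonempty (SingularCohomology R X 0 ≃ₗ[R] SheafCohomology (leraySheaf R f V 0) 0) ∧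
    ∀ n : ℕ, Nonempty (SingularCohomology R X (n + 1) ≃ₗ[R]
      SheafCohomology (leraySheaf R f V (n + 1)) 0 × SheafCohomology (leraySheaf R f V n) 1) := by
  have hopen' : ∀ σ, IsOpen (vertexCover V f σ) := by
    intro σ
    obtain ⟨i, hi⟩ := Finset.card_eq_one.1 σ.2
    have h : vertexCover V f σ = f ⁻¹' V i := by
      simp [vertexCover, nerveSupport, hi]
    rw [h]
    exact isOpen_preimage_of_isOpen_trace hf (hopen i)
  have hcover' : ∀ x, ∃ σ, x ∈ vertexCover V f σ := by
    intro x
    obtain ⟨i, hi⟩ := Set.mem_iUnion.1 (hcover (Set.mem_range_self x))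
    have h : f x ∈ nerveSupport V {i} := by simpa [nerveSupport] using hi
    -- The point f x itself shows that i is a vertex of the nerve; indices with empty V_i are not
    -- vertices.
    exact ⟨⟨⟨{i}, Finset.singleton_nonempty i, _, h⟩, Finset.card_singleton i⟩, h⟩
  have hzero : ∀ n, Nonempty (LinearMap.range (cohomologyRestriction R f V n) ≃ₗ[R]
      SheafCohomology (leraySheaf R f V n) 0) := by
    intro n
    obtain ⟨e⟩ := nonempty_sheafCohomology_zero_equiv (leraySheaf R f V n)
    exact ⟨LinearEquiv.ofEq _ _ (range_cohomologyRestriction hdim hopen' hcover' n) ≪≫ₗ e.symm⟩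
  refine ⟨?_, fun n => ?_⟩
  · obtain ⟨e⟩ := hzero 0
    exact ⟨LinearEquiv.ofInjective (cohomologyRestriction R f V 0) (LinearMap.ker_eq_bot.1
      (ker_cohomologyRestriction_zero hcover')) ≪≫ₗ e⟩
  · obtain ⟨e₀⟩ := hzero (n + 1)
    obtain ⟨e₁⟩ :=
      nonempty_ker_cohomologyRestriction_equiv (R := R) hdim hopen' hcover' n
    obtain ⟨e⟩ := nonempty_linearEquiv_range_prod_ker (cohomologyRestriction R f V (n + 1))
    exact ⟨e ≪≫ₗ LinearEquiv.prodCongr e₀ e₁⟩
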